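/- Setting. Let $X$ be a finite set, $d : X\times X\to\mathbb R$ any function (for instance a metric), $\lambda\in\mathbb R$, and $X^{[2]}=\{(x,y)\in X^2: x\ne y\}$, with uniform distribution $U^2$. A clustering of $X$ is a partition of $X$; it is identified with the function $C$ on pairs with $C(x,y)=1$ if $x,y$ lie in the same cluster and $C(x,y)=0$ otherwise. Let $C^*$ be a target clustering, accessed through the oracle $(x,y)\mapsto C^*(x,y)$, and let $P^+$ and $P^-$ be the uniform distributions on $\{(x,y)\in X^{[2]}: C^*(x,y)=1\}$ and $\{(x,y)\in X^{[2]}: C^*(x,y)=0\}$. Call $d$ $(\alpha,\beta)$-informative (w.r.t. $C^*$ and $\lambda$) if $$\mathbf P_{U^2}[d(x,y)>\lambda \mid C^*(x,y)=1]\le\alpha,\qquad \mathbf P_{U^2}[C^*(x,y)=1\mid d(x,y)\le\lambda]\ge\beta,$$ and $X$ $\gamma$-skewed if $\gamma_0:=\mathbf P_{U^2}[C^*(x,y)=1]\le\gamma$. For weights $w_1,w_2\ge 0$, not both zero, put $\mu=\frac{w_1\gamma_0}{w_1\gamma_0+w_2(1-\gamma_0)}$, and define the normalized correlation loss $$L_{C^*}(C)=\mu\,\mathbf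 P_{(x,y)\sim P^+}[C(x,y)=0]+(1-\mu)\,\mathbf P_{(x,y)\sim P^-}[C(x,y)=1].$$ Samplers. $\mathcal P_0$ repeatedly draws $(x,y)\sim U^2$ independently and outputs the first pair with $C^*(x,y)=0$. $\mathcal P_{11}$ sets $S_x=\{y\ne x: d(x,y)\le\lambda\}$, repeatedly and independently draws $x$ with probability proportional to $|S_x|$ and then $y$ uniformly from $S_x$, and outputs the first pair with $C^*(x,y)=1$. Assume that both loops can terminate, i.e. there is a pair $x\neq y$ with $d(x,y)\le\lambda$ and $C^*(x,y)=1$, and a pair $x\ne y$ with $C^*(x,y)=0$. Algorithm. Given a nonempty class $\mathcal F$ of clusterings of $X$, ERM draws samples $S_+$ (of size $m_+$, by independent runs of $\mathcal P_{11}$) and $S_-$ (of size $m_-$, by independent runs of $\mathcal P_0$, independent of $S_+$), and outputs a minimizer $\hat C$ over $C\in\mathcal F$, with arbitrary tie-breaking, of $$\hat L(C)=\mu\frac{|\{(x,y)\in S_+: C(x,y)=0\}|}{m_+}+(1-\mu)\frac{|\{(x,y)\in S_-: C(x,y)=1\}|}{m_-},$$ where the samples are counted with multiplicity. Theorem. There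 is an absolute constant $a>0$ such that in every such setting, for all $\epsilon,\delta\in(0,1)$ and all $\alpha,\beta,\gamma$: if $d$ is $(\alpha,\beta)$-informative, $X$ is $\gamma$-skewed, and $$m_+,\,m_-\ \ge\ a\,\frac{\mathrm{VCdim}(\mathcal F)+\log(2/\delta)}{\epsilon^2},$$ where $\mathrm{VCdim}(\mathcal F)$ is the VC-dimension of the class of $\{0,1\}$-labellings of $X^{[2]}$ given by $\mathcal F$, then with probability at least $1-\delta$ over the randomness of the sampling, the algorithm terminates and (whatever the tie-breaking) $$L_{C^*}(\hat C)\ \le\ \min_{C\in\mathcal F}L_{C^*}(C)+3\alpha+\epsilon .$$ -/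

import Mathlib

open MeasureTheory ProbabilityTheory

noncomputable section

namespace CorrClust

open scoped Classical in
/-- A clustering of the finite set `X`: a partition of `X` into disjoint nonempty clusters. -/
abbrev Clustering (X : Type*) [Fintype X] : Type _ :=
  Finpartition (Finset.univ : Finset X)

open scoped Classical in
/-- A clustering viewed as a `{0,1}`-valued function on pairs: the value is `1` iff the two
points lie in a common cluster.  For the target clustering this is the same-cluster oracle. -/
def label {X : Type*} [Fintype X] (C : Clustering X) (p : X × X) : Fin 2 :=
  if ∃ s ∈ C.parts, p.1 ∈ s ∧ p.2 ∈ s then 1 else 0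

/-- The set `X^[2]` of ordered pairs of distinct points. -/
def pairs (X : Type*) : Set (X × X) := {p | p.1 ≠ p.2}

/-- The uniform distribution `U²` on `X^[2]`. -/
def unifPairs (X : Type*) [MeasurableSpace X] : Measure (X × X) :=
  uniformOn (pairs X)

/-- The positive (same-cluster) pairs. -/
def posPairs {X : Type*} [Fintype X] (Cs : Clustering X) : Set (X × X) :=
  {p ∈ pairs X | label Cs p = 1}

/-- The negative (different-cluster) pairs. -/
def negPairs {X : Type*} [Fintype X] (Cs : Clustering X) : Set (X × X) :=
  {p ∈ pairs X | label Cs p = 0}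

/-- `d` is `(α, β)`-informative with respect to the target clustering `Cs` and threshold `lam`. -/
def IsInformative {X : Type*} [Fintype X] [MeasurableSpace X] (d : X → X → ℝ)
    (Cs : Clustering X) (lam α β : ℝ) : Prop :=
  (unifPairs X)[|{p | label Cs p = 1}].real {p | lam < d p.1 p.2} ≤ α ∧
    β ≤ (unifPairs X)[|{p | d p.1 p.2 ≤ lam}].real {p | label Cs p = 1}

/-- The probability `γ₀` that a uniformly random pair is positive. -/
def posProb {X : Type*} [Fintype X] [MeasurableSpace X] (Cs : Clustering X) : ℝ :=
  (unifPairs X).real {p | label Cs p = 1}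

/-- `X` is `γ`-skewed with respect to the target clustering `Cs`. -/
def IsSkewed {X : Type*} [Fintype X] [MeasurableSpace X] (Cs : Clustering X) (γ : ℝ) : Prop :=
  posProb Cs ≤ γ

/-- The weight `μ = w₁ γ₀ / (w₁ γ₀ + w₂ (1 - γ₀))`. -/
def lossWeight {X : Type*} [Fintype X] [MeasurableSpace X] (Cs : Clustering X) (w₁ w₂ : ℝ) : ℝ :=
  w₁ * posProb Cs / (w₁ * posProb Cs + w₂ * (1 - posProb Cs))

/-- The normalized correlation loss of `C` with respect to the target `Cs`; the two
distributions `P⁺` and `P⁻` are uniform on the positive and on the negative pairs. -/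
def loss {X : Type*} [Fintype X] [MeasurableSpace X] (Cs : Clustering X) (w₁ w₂ : ℝ)
    (C : Clustering X) : ℝ :=
  lossWeight Cs w₁ w₂ * (uniformOn (posPairs Cs)).real {p | label C p = 0} +
    (1 - lossWeight Cs w₁ w₂) * (uniformOn (negPairs Cs)).real {p | label C p = 1}

open scoped Classical in
/-- The VC-dimension of the class of labellings of `X^[2]` induced by a class of clusterings. -/
def vcDim {X : Type*} [Fintype X] (F : Finset (Clustering X)) : ℕ :=
  (F.image fun C => ({p : X × X | p ∈ pairs X ∧ label C p = 1} : Finset (X × X))).vcDim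

open scoped Classical in
/-- The neighbours `S_x` of a point: the other points within distance `lam`. -/
def nbrs {X : Type*} [Fintype X] (d : X → X → ℝ) (lam : ℝ) (x : X) : Finset X :=
  {y | y ≠ x ∧ d x y ≤ lam}

/-- The law of one trial of the positive sampler: a point `x` is drawn with probability
proportional to `|S_x|`, and then a point `y` uniformly from `S_x`. -/
def posTrial {X : Type*} [Fintype X] [MeasurableSpace X] (d : X → X → ℝ) (lam : ℝ) :
    Measure (X × X) :=
  (((∑ x : X, ((nbrs d lam x).card : ENNReal))⁻¹ •
      ∑ x : X, ((nbrs d lam x).card : ENNReal) • Measure.dirac x : Measure X)).bind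
    fun x => (uniformOn (nbrs d lam x : Set X)).map (Prod.mk x)

open scoped Classical in
/-- The `while` loop of the samplers: given the sequence `ω` of trials, output the first accepted
one.  The value `none` means that the loop does not terminate. -/
def firstAccepted {T : Type*} (accept : T → Prop) (ω : ℕ → T) : Option T :=
  if h : ∃ n, accept (ω n) then some (ω (Nat.find h)) else none

/-- The randomness of the algorithm: a sequence of trials for each of the `mp` runs of the positive
sampler and for each of the `mn` runs of the negative sampler. -/
abbrev Trials (X : Type*) (mp mn : ℕ) : Type _ :=
  (Fin mp → ℕ → X × X) × (Fin mn → ℕ → X × X)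

/-- The law of the randomness: all trials are independent, those of the positive sampler have law
`posTrial`, those of the negative sampler have law `U²`. -/
def trialsLaw {X : Type*} [Fintype X] [MeasurableSpace X] (d : X → X → ℝ) (lam : ℝ)
    (mp mn : ℕ) : Measure (Trials X mp mn) :=
  (Measure.pi fun _ : Fin mp => Measure.infinitePi fun _ : ℕ => posTrial d lam).prod
    (Measure.pi fun _ : Fin mn => Measure.infinitePi fun _ : ℕ => unifPairs X)

/-- The fraction of the pairs of a sample that `C` labels by `b`. -/
def sampleFreq {X : Type*} [Fintype X] {m : ℕ} (S : Fin m → X × X) (C : Clustering X)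
    (b : Fin 2) : ℝ :=
  (Finset.card {i : Fin m | label C (S i) = b} : ℝ) / m

/-- The empirical loss of `C` on the samples `Sp` (positive) and `Sn` (negative). -/
def empLoss {X : Type*} [Fintype X] [MeasurableSpace X] (Cs : Clustering X) (w₁ w₂ : ℝ)
    {mp mn : ℕ} (Sp : Fin mp → X × X) (Sn : Fin mn → X × X) (C : Clustering X) : ℝ :=
  lossWeight Cs w₁ w₂ * sampleFreq Sp C 0 + (1 - lossWeight Cs w₁ w₂) * sampleFreq Sn C 1

/-- With randomness `ω`, every run of the two samplers terminates, and `Chat` is a possible output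
of empirical risk minimization over `F`: a minimizer in `F` of the empirical loss on the samples
drawn (the tie-breaking is arbitrary). -/
def IsERMOutput {X : Type*} [Fintype X] [MeasurableSpace X] (Cs : Clustering X) (w₁ w₂ : ℝ)
    (F : Finset (Clustering X)) {mp mn : ℕ} (ω : Trials X mp mn) (Chat : Clustering X) : Prop :=
  ∃ (Sp : Fin mp → X × X) (Sn : Fin mn → X × X),
    (∀ i, firstAccepted (fun p => label Cs p = 1) (ω.1 i) = some (Sp i)) ∧
    (∀ i, firstAccepted (fun p => label Cs p = 0) (ω.2 i) = some (Sn i)) ∧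
    Chat ∈ F ∧ ∀ C ∈ F, empLoss Cs w₁ w₂ Sp Sn Chat ≤ empLoss Cs w₁ w₂ Sp Sn C

end CorrClust

end

/-! Rejection sampling outputs the conditional law. Choosing `x` with weight `|S_x|` and then `y`
uniformly in `S_x` is uniform on the close pairs, so the positive sampler ends up uniform on the set
`G` of close positive pairs, and the negative one uniform on all negative pairs. Informativeness
says that `G` misses at most an `α`-fraction of the positive pairs, so replacing `P⁺` by the uniform
law on `G` moves every probability by at most `α` (`abs_uniformOn_sub_uniformOn_le`). If in addition
all empirical frequencies over `F` are within `ε / 2` of their means, comparing the minimizer with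
any competitor costs at most `2α + ε` (`loss_le_of_isERM`).

The substance is uniform convergence at the rate `(VC + log(2/δ)) / ε²`, with no additional
logarithm of `1/ε` (`measure_exists_lt_abs_empFreq_sub_le_of_card`). A ghost sample and random swaps
reduce it to Rademacher sums on a fixed double sample. There a plain union bound over all traces
would lose a logarithm; instead the class is approximated by nets at scales `4^(-k)`, whose sizes
are controlled by Dudley's bound `card_le_of_separated`, and Hoeffding's inequality is applied to
the links between successive nets (`card_exists_lt_abs_signedSum_le`). -/

namespace CorrClust

/-! ### Packing numbers of VC classes. -/

section Packing

open Finset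

/-- Pulling a set family back along a map does not increase its VC-dimension. -/
lemma vcDim_image_preimage_le {T κ : Type*} [DecidableEq T] [DecidableEq κ] [Fintype κ]
    (𝒜 : Finset (Finset T)) (z : κ → T) :
    (𝒜.image fun h => (univ.filter fun j => z j ∈ h)).vcDim ≤ 𝒜.vcDim := by
  refine Finset.sup_le fun s hs => ?_
  rw [mem_shatterer] at hs
  -- Indices with the same image under `z` belong to the same traces, so a shattered set cannot
  -- contain two of them.
  have hinj : Set.InjOn z s := by
    intro a ha b hb hab
    obtain ⟨t, ht, hst⟩ := hs.exists_inter_eq_singleton ha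
    obtain ⟨h, -, rfl⟩ := mem_image.1 ht
    have h1 : a ∈ s ∩ univ.filter fun j => z j ∈ h := by rw [hst]; simp
    have h2 : b ∈ s ∩ univ.filter fun j => z j ∈ h := by
      simp only [mem_inter, mem_filter, mem_univ, true_and] at h1 ⊢
      exact ⟨hb, hab ▸ h1.2⟩
    rw [hst, mem_singleton] at h2
    exact h2.symm
  rw [← card_image_of_injOn hinj]
  apply Shatters.card_le_vcDim
  intro t ht
  obtain ⟨u, hu, hsu⟩ := hs (filter_subset (fun j => z j ∈ t) s)
  obtain ⟨h, hh, rfl⟩ := mem_image.1 hu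
  refine ⟨h, hh, ?_⟩
  ext y
  simp only [mem_inter, mem_image]
  constructor
  · rintro ⟨⟨j, hj, rfl⟩, hy⟩
    have : j ∈ s ∩ univ.filter fun j => z j ∈ h := by simp [hj, hy]
    rw [hsu] at this
    exact (mem_filter.1 this).2
  · intro hy
    obtain ⟨j, hj, rfl⟩ := mem_image.1 (ht hy)
    refine ⟨⟨j, hj, rfl⟩, ?_⟩
    have : j ∈ s.filter fun j => z j ∈ t := by simp [hj, hy]
    rw [← hsu] at this
    simpa using (mem_inter.1 this).2

/-- Since `x ^ D ≤ x ^ k` for `k ≤ D`, multiplying the sum by `x ^ D` puts it below the binomial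
expansion of `(1 + x) ^ l ≤ exp (x * l)`. The free parameter `x` lets the packing bound choose how
fast the exponential grows. -/
lemma sum_choose_le (D l : ℕ) {x : ℝ} (hx : 0 < x) (hx1 : x ≤ 1) :
    (∑ k ∈ Iic D, (l.choose k : ℝ)) ≤ (1 / x) ^ D * Real.exp (x * l) := by
  have h1 : (1 + x) ^ l ≤ Real.exp (x * l) := by
    rw [mul_comm, Real.exp_nat_mul]
    exact pow_le_pow_left₀ (by positivity) (by linarith [Real.add_one_le_exp x]) _
  have h2 : x ^ D * ∑ k ∈ Iic D, (l.choose k : ℝ) ≤ (1 + x) ^ l := by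
    have e : (1 + x) ^ l = ∑ k ∈ range (l + 1), x ^ k * (l.choose k : ℝ) := by
      rw [add_comm, add_pow]; simp
    rw [e, mul_sum]
    calc ∑ k ∈ Iic D, x ^ D * (l.choose k : ℝ)
        ≤ ∑ k ∈ Iic D, x ^ k * (l.choose k : ℝ) := by
          refine sum_le_sum fun k hk => ?_
          exact mul_le_mul_of_nonneg_right
            (pow_le_pow_of_le_one hx.le hx1 (mem_Iic.1 hk)) (by positivity)
      _ ≤ ∑ k ∈ Iic D ∪ range (l + 1), x ^ k * (l.choose k : ℝ) :=
          sum_le_sum_of_subset_of_nonneg subset_union_left fun _ _ _ => by positivity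
      _ = ∑ k ∈ range (l + 1), x ^ k * (l.choose k : ℝ) := by
          symm
          refine sum_subset subset_union_right fun k _ hk => ?_
          rw [Nat.choose_eq_zero_of_lt (by simpa using hk)]; simp
  rw [one_div, inv_pow, inv_mul_eq_div, le_div_iff₀ (by positivity), mul_comm]
  exact h2.trans h1

/-- Points of `ι` on which the traces of `h` and `h'` differ. -/
def traceDiff {T ι : Type*} [DecidableEq T] [Fintype ι] (z : ι → T) (h h' : Finset T) :
    Finset ι :=
  univ.filter fun j => ¬ (z j ∈ h ↔ z j ∈ h')

/-- If any two members of a finite family differ on an `η`-fraction of the points, some sequence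
of `l` points, with `l` logarithmic in the size of the family, tells all members apart. -/
lemma exists_separating_points {T ι : Type*} [DecidableEq T] [Fintype ι] [DecidableEq ι]
    [Nonempty ι] (z : ι → T) (ℳ : Finset (Finset T)) {η : ℝ}
    (hsep : ∀ h ∈ ℳ, ∀ h' ∈ ℳ, h ≠ h' → η * Fintype.card ι ≤ (traceDiff z h h').card) (l : ℕ)
    (hl : (ℳ.card : ℝ) ^ 2 * Real.exp (-(η * l)) < 1) :
    ∃ w : Fin l → ι, ∀ h ∈ ℳ, ∀ h' ∈ ℳ, h ≠ h' → ∃ i, w i ∈ traceDiff z h h' := by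
  by_contra! hcon
  have hn : (0 : ℝ) < Fintype.card ι := by exact_mod_cast Fintype.card_pos
  -- Union bound by counting: `B` collects the sequences that miss the difference set of some pair.
  -- Each pair contributes at most `n ^ l * exp (-(η * l))` of them, where `n` is the number of
  -- points, so `B` cannot be everything.
  set B : Finset (Fin l → ι) := ((ℳ ×ˢ ℳ).filter fun p => p.1 ≠ p.2).biUnion fun p =>
    Fintype.piFinset fun _ => (traceDiff z p.1 p.2)ᶜ with hB
  have huniv : (univ : Finset (Fin l → ι)) ⊆ B := by
    intro w _
    obtain ⟨h, hh, h', hh', hne, hw⟩ := hcon w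
    simp only [hB, mem_biUnion, mem_filter, mem_product]
    exact ⟨(h, h'), ⟨⟨hh, hh'⟩, hne⟩, by simpa [Fintype.mem_piFinset] using hw⟩
  have hcard : (B.card : ℝ) ≤
      (ℳ.card : ℝ) ^ 2 * ((Fintype.card ι : ℝ) ^ l * Real.exp (-(η * l))) := by
    have hp : ∀ p ∈ (ℳ ×ˢ ℳ).filter fun p => p.1 ≠ p.2,
        ((Fintype.piFinset fun _ : Fin l => (traceDiff z p.1 p.2)ᶜ).card : ℝ) ≤
          (Fintype.card ι : ℝ) ^ l * Real.exp (-(η * l)) := by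
      intro p hp
      simp only [mem_filter, mem_product] at hp
      have h1 := hsep _ hp.1.1 _ hp.1.2 hp.2
      rw [Fintype.card_piFinset_const, card_compl, Nat.cast_pow,
        Nat.cast_sub (card_le_univ _)]
      have h2 : (Fintype.card ι : ℝ) - (traceDiff z p.1 p.2).card ≤
          Fintype.card ι * Real.exp (-η) := by
        nlinarith [Real.add_one_le_exp (-η)]
      calc _ ≤ (Fintype.card ι * Real.exp (-η)) ^ l := by
            refine pow_le_pow_left₀ ?_ h2 _
            rw [sub_nonneg]; exact_mod_cast card_le_univ _
        _ = _ := by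
            rw [mul_pow, ← Real.exp_nat_mul]; congr 2; ring
    calc (B.card : ℝ) ≤ ∑ p ∈ (ℳ ×ˢ ℳ).filter fun p => p.1 ≠ p.2,
            ((Fintype.piFinset fun _ : Fin l => (traceDiff z p.1 p.2)ᶜ).card : ℝ) := by
          exact_mod_cast card_biUnion_le
      _ ≤ _ := sum_le_sum hp
      _ ≤ _ := by
          rw [sum_const, nsmul_eq_mul]
          refine mul_le_mul_of_nonneg_right ?_ (by positivity)
          have := card_filter_le (ℳ ×ˢ ℳ) fun p => p.1 ≠ p.2
          rw [card_product] at this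
          rw [sq]; exact_mod_cast this
  have h3 : (Fintype.card ι : ℝ) ^ l ≤ B.card := by
    have := card_le_card huniv
    rw [card_univ, Fintype.card_fun, Fintype.card_fin] at this
    exact_mod_cast this
  have h4 : 0 < (Fintype.card ι : ℝ) ^ l := by positivity
  nlinarith

/-- **Dudley's packing bound.** -/
lemma card_le_of_separated {T ι : Type*} [DecidableEq T] [Fintype ι] [DecidableEq ι]
    [Nonempty ι] (z : ι → T) (𝒜 ℳ : Finset (Finset T)) (hℳ : ℳ ⊆ 𝒜) {η : ℝ} (hη : 0 < η)
    (hη1 : η ≤ 1)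
    (hsep : ∀ h ∈ ℳ, ∀ h' ∈ ℳ, h ≠ h' → η * Fintype.card ι ≤ (traceDiff z h h').card) :
    (ℳ.card : ℝ) ≤ 2 * (4 / η) ^ (2 * 𝒜.vcDim) := by
  rcases ℳ.eq_empty_or_nonempty with rfl | hne
  · simp; positivity
  have hN : (1 : ℝ) ≤ ℳ.card := by exact_mod_cast hne.card_pos
  set N : ℝ := (ℳ.card : ℝ) with hNdef
  have hlog : 0 ≤ Real.log N := Real.log_nonneg hN
  -- This is just large enough for `N ^ 2 * exp (-(η * l)) < 1`.
  set l : ℕ := ⌊2 * Real.log N / η⌋₊ + 1 with hl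
  have hl1 : 2 * Real.log N < η * l := by
    have := Nat.lt_floor_add_one (2 * Real.log N / η)
    rw [div_lt_iff₀ hη] at this
    rw [hl]; push_cast; linarith
  have hl2 : η * l ≤ 2 * Real.log N + 1 := by
    have := Nat.floor_le (a := 2 * Real.log N / η) (by positivity)
    rw [le_div_iff₀ hη] at this
    rw [hl]; push_cast; nlinarith
  obtain ⟨w, hw⟩ := exists_separating_points z ℳ hsep l (by
    have : N ^ 2 = Real.exp (2 * Real.log N) := by
      rw [two_mul, Real.exp_add, Real.exp_log (by linarith), sq]
    rw [this, ← Real.exp_add, Real.exp_lt_one_iff]; linarith)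
  set 𝒯 := 𝒜.image fun h => (univ.filter fun j => (z ∘ w) j ∈ h) with h𝒯
  have h1 : ℳ.card ≤ 𝒯.card := by
    refine card_le_card_of_injOn (fun h => univ.filter fun j => (z ∘ w) j ∈ h)
      (fun h hh => mem_image_of_mem _ (hℳ hh)) ?_
    intro h hh h' hh' heq
    by_contra hne'
    obtain ⟨i, hi⟩ := hw h hh h' hh' hne'
    have := Finset.ext_iff.1 heq i
    simp [traceDiff] at hi this
    tauto
  have h2 : 𝒯.card ≤ ∑ k ∈ Iic 𝒜.vcDim, l.choose k := by
    refine (card_le_card_shatterer _).trans (card_shatterer_le_sum_vcDim.trans ?_)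
    rw [Fintype.card_fin]
    exact sum_le_sum_of_subset (Iic_subset_Iic.2 (vcDim_image_preimage_le 𝒜 (z ∘ w)))
  -- Sauer–Shelah on `l` points bounds `N` in terms of `l`, which itself depends on `log N`. With `x
  -- = η / 4` the exponential is only about `√N`, so one factor `√N` cancels; squaring then gives
  -- the bound, with `2 ≥ exp (1 / 2)`.
  have h3 : N ≤ (4 / η) ^ 𝒜.vcDim * Real.exp (η / 4 * l) := by
    have h5 := sum_choose_le 𝒜.vcDim l (x := η / 4) (by positivity) (by linarith)
    rw [one_div_div] at h5
    refine le_trans ?_ h5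
    rw [hNdef]; exact_mod_cast h1.trans h2
  set s := Real.sqrt N with hs
  have hs0 : 0 < s := Real.sqrt_pos.2 (by linarith)
  have hss : s * s = N := Real.mul_self_sqrt (by linarith)
  have h4 : Real.exp (η / 4 * l) ≤ s * Real.exp (1 / 4) := by
    have : s = Real.exp (Real.log N / 2) := by
      rw [hs, Real.sqrt_eq_rpow, Real.rpow_def_of_pos (by linarith)]; congr 1; ring
    rw [this, ← Real.exp_add]
    exact Real.exp_le_exp.2 (by linarith)
  have h6 : Real.exp (1 / 4) * Real.exp (1 / 4) ≤ 2 := by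
    rw [← Real.exp_add]
    have h7 : Real.exp (1 / 4 + 1 / 4) * Real.exp (1 / 4 + 1 / 4) = Real.exp 1 := by
      rw [← Real.exp_add]; norm_num
    have h8 := Real.exp_one_lt_d9
    nlinarith [Real.exp_pos (1 / 4 + 1 / 4 : ℝ)]
  set Q := (4 / η) ^ 𝒜.vcDim with hQ
  have hQ0 : 0 < Q := by positivity
  have h9 : s ≤ Q * Real.exp (1 / 4) := by
    have : s * s ≤ Q * Real.exp (1 / 4) * s := by rw [hss]; nlinarith
    exact le_of_mul_le_mul_right this hs0
  calc N = s * s := hss.symm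
    _ ≤ (Q * Real.exp (1 / 4)) * (Q * Real.exp (1 / 4)) := by gcongr
    _ = Q ^ 2 * (Real.exp (1 / 4) * Real.exp (1 / 4)) := by ring
    _ ≤ Q ^ 2 * 2 := by gcongr
    _ = 2 * (4 / η) ^ (2 * 𝒜.vcDim) := by rw [hQ, ← pow_mul, mul_comm 𝒜.vcDim 2]; ring

/-- Maximal separated subsets are covering. -/
lemma exists_maximal_separated {β : Type*} [DecidableEq β] (s : Finset β) (R : β → β → Prop)
    (hrefl : ∀ a, R a a) (hsymm : ∀ a b, R a b → R b a) :
    ∃ M ⊆ s, (∀ a ∈ M, ∀ b ∈ M, a ≠ b → ¬ R a b) ∧ ∀ a ∈ s, ∃ b ∈ M, R a b := by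
  classical
  obtain ⟨M, hM, hmax⟩ := exists_max_image
    (s.powerset.filter fun M => ∀ a ∈ M, ∀ b ∈ M, a ≠ b → ¬ R a b) card ⟨∅, by simp⟩
  simp only [mem_filter, mem_powerset] at hM hmax
  refine ⟨M, hM.1, hM.2, fun a ha => ?_⟩
  by_contra! hcon
  have haM : a ∉ M := fun h => hcon a h (hrefl a)
  have := hmax (insert a M) ⟨insert_subset ha hM.1, by
    intro x hx y hy hxy
    rw [mem_insert] at hx hy
    rcases hx with rfl | hx <;> rcases hy with rfl | hy
    · exact absurd rfl hxy
    · exact hcon y hy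
    · exact fun h => hcon x hx (hsymm _ _ h)
    · exact hM.2 x hx y hy hxy⟩
  rw [card_insert_of_notMem haM] at this
  omega

end Packing


/-! ### Rademacher sums over a VC class: Hoeffding's inequality and chaining. -/

section Rademacher

open Finset

variable {κ : Type*} [Fintype κ]

/-- The signed sum `∑ ± v i`, with signs given by `σ`. -/
def signedSum (σ : κ → Bool) (v : κ → ℝ) : ℝ := ∑ i, (if σ i then v i else -v i)

lemma signedSum_neg (σ : κ → Bool) (v : κ → ℝ) : signedSum σ (-v) = -signedSum σ v := by
  simp only [signedSum, ← sum_neg_distrib]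
  refine sum_congr rfl fun i _ => ?_
  split_ifs <;> simp

lemma signedSum_sub (σ : κ → Bool) (v w : κ → ℝ) :
    signedSum σ (v - w) = signedSum σ v - signedSum σ w := by
  simp only [signedSum, ← sum_sub_distrib]
  refine sum_congr rfl fun i _ => ?_
  split_ifs <;> simp; ring

/-- The sum over signs factorizes into a product of `2 cosh (v i)`, and `cosh t ≤ exp (t ^ 2 / 2)`.
-/
lemma sum_exp_signedSum_le [DecidableEq κ] (v : κ → ℝ) :
    ∑ σ : κ → Bool, Real.exp (signedSum σ v) ≤
      2 ^ Fintype.card κ * Real.exp ((∑ i, v i ^ 2) / 2) := by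
  have h1 : ∑ σ : κ → Bool, Real.exp (signedSum σ v) =
      ∏ i, ∑ b : Bool, Real.exp (if b then v i else -v i) := by
    rw [Fintype.prod_sum]
    simp only [signedSum, Real.exp_sum]
  rw [h1, sum_div, Real.exp_sum, ← card_univ, ← prod_const, ← prod_mul_distrib]
  refine prod_le_prod (fun i _ => by positivity) fun i _ => ?_
  have := Real.cosh_le_exp_half_sq (v i)
  rw [Real.cosh_eq] at this
  simp only [Fintype.univ_bool, mem_singleton, Bool.true_eq_false, not_false_eq_true,
    sum_insert, sum_singleton, if_true, Bool.false_eq_true, if_false]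
  linarith

lemma card_lt_signedSum_le [DecidableEq κ] (v : κ → ℝ) {V t : ℝ} (hV : 0 < V) (ht : 0 ≤ t)
    (hv : ∑ i, v i ^ 2 ≤ V) :
    ((univ.filter fun σ : κ → Bool => t < signedSum σ v).card : ℝ) ≤
      2 ^ Fintype.card κ * Real.exp (-(t ^ 2 / (2 * V))) := by
  -- The Chernoff parameter minimizing `c ^ 2 * V / 2 - c * t`.
  set c := t / V with hc
  have hc0 : 0 ≤ c := by positivity
  have h1 : ((univ.filter fun σ : κ → Bool => t < signedSum σ v).card : ℝ) * Real.exp (c * t) ≤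
      ∑ σ : κ → Bool, Real.exp (signedSum σ (c • v)) := by
    rw [← nsmul_eq_mul, ← sum_const]
    refine (sum_le_sum fun σ hσ => ?_).trans
      (sum_le_sum_of_subset_of_nonneg (subset_univ _) fun _ _ _ => by positivity)
    have : signedSum σ (c • v) = c * signedSum σ v := by
      simp only [signedSum, mul_sum]
      refine sum_congr rfl fun i _ => ?_
      split_ifs <;> simp
    rw [this]
    exact Real.exp_le_exp.2 (mul_le_mul_of_nonneg_left (mem_filter.1 hσ).2.le hc0)
  have h2 := h1.trans (sum_exp_signedSum_le (c • v))
  have h3 : ∑ i, (c • v) i ^ 2 ≤ c ^ 2 * V := by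
    simp only [Pi.smul_apply, smul_eq_mul, mul_pow, ← mul_sum]
    gcongr
  have h4 : Real.exp ((∑ i, (c • v) i ^ 2) / 2) ≤
      Real.exp (-(t ^ 2 / (2 * V))) * Real.exp (c * t) := by
    rw [← Real.exp_add]
    refine Real.exp_le_exp.2 ?_
    have e1 : c ^ 2 * V = t ^ 2 / V := by rw [hc]; field_simp
    have e2 : c * t = t ^ 2 / V := by rw [hc]; ring
    have e3 : t ^ 2 / (2 * V) = t ^ 2 / V / 2 := by field_simp
    rw [e1] at h3
    rw [e2, e3]; linarith
  have h5 := h2.trans (mul_le_mul_of_nonneg_left h4 (by positivity))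
  rw [← mul_assoc] at h5
  exact le_of_mul_le_mul_right h5 (Real.exp_pos _)

/-- Hoeffding's inequality for Rademacher sums. -/
lemma card_lt_abs_signedSum_le [DecidableEq κ] (v : κ → ℝ) {V t : ℝ} (hV : 0 < V) (ht : 0 ≤ t)
    (hv : ∑ i, v i ^ 2 ≤ V) :
    ((univ.filter fun σ : κ → Bool => t < |signedSum σ v|).card : ℝ) ≤
      2 ^ Fintype.card κ * (2 * Real.exp (-(t ^ 2 / (2 * V)))) := by
  have h1 := card_lt_signedSum_le v hV ht hv
  have h2 := card_lt_signedSum_le (-v) hV ht (by simpa using hv)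
  have h3 : (univ.filter fun σ : κ → Bool => t < |signedSum σ v|) ⊆
      (univ.filter fun σ : κ → Bool => t < signedSum σ v) ∪
        (univ.filter fun σ : κ → Bool => t < signedSum σ (-v)) := by
    intro σ hσ
    simp only [mem_union, mem_filter, mem_univ, true_and, signedSum_neg] at hσ ⊢
    exact lt_abs.1 hσ
  have h4 : ((univ.filter fun σ : κ → Bool => t < |signedSum σ v|).card : ℝ) ≤
      (univ.filter fun σ : κ → Bool => t < signedSum σ v).card +
        (univ.filter fun σ : κ → Bool => t < signedSum σ (-v)).card := by
    exact_mod_cast (card_le_card h3).trans (card_union_le _ _)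
  linarith

lemma card_biUnion_le_card_mul_real {β γ : Type*} [DecidableEq γ] (s : Finset β)
    (f : β → Finset γ) {c : ℝ} (h : ∀ a ∈ s, ((f a).card : ℝ) ≤ c) :
    ((s.biUnion f).card : ℝ) ≤ s.card * c := by
  rw [← nsmul_eq_mul, ← sum_const]
  refine le_trans ?_ (sum_le_sum h)
  exact_mod_cast card_biUnion_le

/-- The differences of the indicator of `h` along pairs of points. -/
def pairDiff {T : Type*} [DecidableEq T] (x : κ → T × T) (h : Finset T) (i : κ) : ℝ :=
  (if (x i).1 ∈ h then 1 else 0) - (if (x i).2 ∈ h then 1 else 0)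

lemma sum_pairDiff_sq_le {T : Type*} [DecidableEq T] (x : κ → T × T) (h : Finset T) :
    ∑ i, pairDiff x h i ^ 2 ≤ Fintype.card κ := by
  rw [← card_univ, ← nsmul_one, ← sum_const]
  refine sum_le_sum fun i _ => ?_
  unfold pairDiff
  split_ifs <;> norm_num

/-- Coordinatewise this is `(a - b) ^ 2 ≤ 2 * (|a| + |b|)` for `a, b ∈ {-1, 0, 1}`. It turns
closeness of traces into a small variance for the links of the chain. -/
lemma sum_pairDiff_sub_sq_le {T : Type*} [DecidableEq T] (x : κ → T × T) (h h' : Finset T) :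
    ∑ i, (pairDiff x h - pairDiff x h') i ^ 2 ≤
      2 * (traceDiff (Sum.elim (fun i => (x i).1) fun i => (x i).2) h h').card := by
  rw [traceDiff, card_filter, Fintype.sum_sum_type]
  push_cast
  rw [← sum_add_distrib, mul_sum]
  refine sum_le_sum fun i _ => ?_
  simp only [pairDiff, Pi.sub_apply, Sum.elim_inl, Sum.elim_inr]
  by_cases h1 : (x i).1 ∈ h <;> by_cases h2 : (x i).2 ∈ h <;> by_cases h3 : (x i).1 ∈ h' <;>
    by_cases h4 : (x i).2 ∈ h' <;> simp [h1, h2, h3, h4] <;> norm_num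

/-- Net size times Hoeffding tail at level `k`. By Bernoulli `(9 / 4) ^ k ≥ k + 1`, so the tail
exponent is at least `12 * L * (k + 1)`: half of it absorbs the net, and the other half pays for
`log (2 / δ)` once and for `5 * log 2` at each level. -/
lemma exp_chaining_bound {D L δ A : ℝ} (hD : 0 ≤ D) (hδ : 0 < δ) (hδ1 : δ < 1)
    (hL : L = D + Real.log (2 / δ)) (hA : 12 * L ≤ A) (k : ℕ) :
    2 * Real.exp (6 * D * (k + 1)) * (2 * Real.exp (-(A * (9 / 4) ^ k))) ≤
      δ / 2 * (1 / 2) ^ (k + 3) := by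
  have hlog2 : Real.log 2 ≤ Real.log (2 / δ) := by
    apply Real.log_le_log (by norm_num)
    rw [le_div_iff₀ hδ]; linarith
  have hl2 : 0 < Real.log 2 := Real.log_pos (by norm_num)
  have hL0 : 0 < L := by rw [hL]; linarith
  have hb : (k : ℝ) + 1 ≤ (9 / 4 : ℝ) ^ k := by
    have := one_add_mul_le_pow (a := (5 / 4 : ℝ)) (by norm_num) k
    have h0 : (0 : ℝ) ≤ k := by positivity
    norm_num at this
    linarith
  have h1 : 6 * D * (k + 1) + -(A * (9 / 4) ^ k) ≤
      -Real.log (2 / δ) + (k + 1 : ℕ) * (-(5 * Real.log 2)) := by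
    have h2 : 12 * L * (k + 1) ≤ A * (9 / 4) ^ k :=
      mul_le_mul hA hb (by positivity) (by linarith)
    have h0 : (0 : ℝ) ≤ k := by positivity
    have h3 : D * (k + 1) ≤ L * (k + 1) := by
      apply mul_le_mul_of_nonneg_right _ (by positivity); linarith
    have h4 : Real.log 2 * (k + 1) ≤ L * (k + 1) := by
      apply mul_le_mul_of_nonneg_right _ (by positivity); linarith
    have h5 : Real.log (2 / δ) ≤ L * (k + 1) := by nlinarith
    push_cast
    nlinarith
  have h6 : Real.exp (5 * Real.log 2) = 32 := by
    rw [show (5 : ℝ) * Real.log 2 = ((5 : ℕ) : ℝ) * Real.log 2 by norm_num, Real.exp_nat_mul,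
      Real.exp_log (by norm_num)]
    norm_num
  calc 2 * Real.exp (6 * D * (k + 1)) * (2 * Real.exp (-(A * (9 / 4) ^ k)))
      = 4 * Real.exp (6 * D * (k + 1) + -(A * (9 / 4) ^ k)) := by rw [Real.exp_add]; ring
    _ ≤ 4 * Real.exp (-Real.log (2 / δ) + (k + 1 : ℕ) * (-(5 * Real.log 2))) := by
        gcongr
    _ = 4 * (δ / 2 * (1 / 32) ^ (k + 1)) := by
        rw [Real.exp_add, Real.exp_nat_mul, Real.exp_neg, Real.exp_neg, h6,
          Real.exp_log (by positivity), inv_div, one_div]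
    _ ≤ δ / 2 * (1 / 2) ^ (k + 3) := by
        have h7 : (1 / 32 : ℝ) ^ k ≤ (1 / 2) ^ k :=
          pow_le_pow_left₀ (by norm_num) (by norm_num) _
        rw [pow_succ, pow_add]
        nlinarith [mul_le_mul_of_nonneg_left h7 hδ.le]

/-- Uniform deviation bound for Rademacher averages over a VC class, by chaining. -/
theorem card_exists_lt_abs_signedSum_le {T : Type*} [DecidableEq T] [DecidableEq κ]
    [Nonempty κ] (x : κ → T × T) (𝒜 : Finset (Finset T)) {ε δ : ℝ} (hε : 0 < ε) (hδ : 0 < δ) (hδ1 : δ < 1)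
    (hm : 9600 * ((𝒜.vcDim : ℝ) + Real.log (2 / δ)) ≤ Fintype.card κ * ε ^ 2) :
    ((univ.filter fun σ : κ → Bool =>
        ∃ h ∈ 𝒜, Fintype.card κ * ε / 2 < |signedSum σ (pairDiff x h)|).card : ℝ) ≤
      2 ^ Fintype.card κ * (δ / 2) := by
  classical
  set m : ℝ := (Fintype.card κ : ℝ) with hmdef
  have hm0 : 0 < m := by rw [hmdef]; exact_mod_cast Fintype.card_pos
  set D := 𝒜.vcDim with hD
  set L := (D : ℝ) + Real.log (2 / δ) with hL
  -- The Hoeffding exponent of level `0` for threshold `m * ε / 10` and variance proxy `4 * m`. The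
  -- constant 9600 in the hypothesis is `12 * 800`.
  set A := m * ε ^ 2 / 800 with hA
  have hAL : 12 * L ≤ A := by rw [hA]; linarith
  set z : κ ⊕ κ → T := Sum.elim (fun i => (x i).1) fun i => (x i).2 with hz
  have hn : (Fintype.card (κ ⊕ κ) : ℝ) = 2 * m := by
    rw [Fintype.card_sum]; push_cast; ring
  -- Nets at relative scale `4 ^ (-k)` on the `2 * m` points of the double sample. Dudley's bound
  -- gives `2 * 16 ^ (D * (k + 1))`, and `16 ≤ exp 3`.
  have hnet : ∀ k : ℕ, ∃ M ⊆ 𝒜, (M.card : ℝ) ≤ 2 * Real.exp (3 * D * (k + 1)) ∧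
      ∀ h ∈ 𝒜, ∃ h' ∈ M, ((traceDiff z h h').card : ℝ) < (1 / 4) ^ k * (2 * m) := by
    intro k
    obtain ⟨M, hM, hsep, hcov⟩ := exists_maximal_separated 𝒜
      (fun h h' => ((traceDiff z h h').card : ℝ) < (1 / 4) ^ k * (2 * m))
      (fun h => by simp [traceDiff]; positivity)
      (fun h h' hh => by simpa only [traceDiff, iff_comm] using hh)
    refine ⟨M, hM, ?_, hcov⟩
    refine (card_le_of_separated z 𝒜 M hM (η := (1 / 4) ^ k) (by positivity)
      (pow_le_one₀ (by norm_num) (by norm_num)) ?_).trans ?_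
    · intro h hh h' hh' hne
      rw [hn]
      exact not_lt.1 (hsep h hh h' hh' hne)
    · have e1 : (4 / (1 / 4) ^ k : ℝ) ^ (2 * 𝒜.vcDim) = (16 : ℝ) ^ (D * (k + 1)) := by
        rw [one_div, inv_pow, div_inv_eq_mul, ← pow_succ', pow_mul', ← pow_mul, ← pow_mul, hD,
          show (16 : ℝ) = 4 ^ 2 by norm_num, ← pow_mul]
        congr 1; ring
      have e2 : (16 : ℝ) ≤ Real.exp 3 := by
        have := Real.exp_one_gt_d9
        have h3 : Real.exp 3 = Real.exp 1 ^ 3 := by rw [← Real.exp_nat_mul]; norm_num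
        rw [h3]
        calc (16 : ℝ) ≤ 2.7 ^ 3 := by norm_num
          _ ≤ _ := pow_le_pow_left₀ (by norm_num) (by linarith) _
      rw [e1]
      have e3 : Real.exp (3 * D * (k + 1)) = Real.exp 3 ^ (D * (k + 1)) := by
        rw [← Real.exp_nat_mul]; congr 1; push_cast; ring
      rw [e3]
      gcongr
  choose M hM𝒜 hMcard hMcov using hnet
  have hD0 : (0 : ℝ) ≤ D := by positivity
  -- The thresholds start at `m * ε / 10`, grow by `m * ε / 10 * (3 / 4) ^ k` at link `k`, and stay
  -- below `m * ε / 2`; the failure fractions likewise stay below `δ / 2`.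
  have hlevel : ∀ K : ℕ, ((univ.filter fun σ : κ → Bool => ∃ h ∈ M K,
      m * ε / 10 * (5 - 4 * (3 / 4) ^ K) < |signedSum σ (pairDiff x h)|).card : ℝ) ≤
        2 ^ Fintype.card κ * (δ / 2 * (1 - (1 / 2) ^ (K + 1))) := by
    intro K
    induction K with
    | zero =>
      have hsub : (univ.filter fun σ : κ → Bool => ∃ h ∈ M 0,
          m * ε / 10 * (5 - 4 * (3 / 4) ^ 0) < |signedSum σ (pairDiff x h)|) ⊆
          (M 0).biUnion fun h => univ.filter fun σ : κ → Bool =>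
            m * ε / 10 < |signedSum σ (pairDiff x h)| := by
        intro σ hσ
        simp only [mem_filter, mem_univ, true_and, mem_biUnion] at hσ ⊢
        obtain ⟨h, hh, h1⟩ := hσ
        refine ⟨h, hh, ?_⟩
        norm_num at h1
        exact h1
      have hone : ∀ h ∈ M 0, ((univ.filter fun σ : κ → Bool =>
          m * ε / 10 < |signedSum σ (pairDiff x h)|).card : ℝ) ≤
            2 ^ Fintype.card κ * (2 * Real.exp (-A)) := by
        intro h _
        -- Here `m` would do as variance proxy; `4 * m` makes the exponent the case `k = 0` of the
        -- general one.
        have := card_lt_abs_signedSum_le (pairDiff x h) (V := 4 * m) (t := m * ε / 10)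
          (by positivity) (by positivity) ((sum_pairDiff_sq_le x h).trans (by linarith))
        have e : (m * ε / 10) ^ 2 / (2 * (4 * m)) = A := by rw [hA]; field_simp; norm_num
        rwa [e] at this
      have h1 : (((M 0).biUnion fun h => univ.filter fun σ : κ → Bool =>
            m * ε / 10 < |signedSum σ (pairDiff x h)|).card : ℝ) ≤
          (M 0).card * (2 ^ Fintype.card κ * (2 * Real.exp (-A))) :=
        card_biUnion_le_card_mul_real _ _ hone
      have h2 := exp_chaining_bound hD0 hδ hδ1 hL hAL 0
      have h3 : ((M 0).card : ℝ) ≤ 2 * Real.exp (6 * D * ((0 : ℕ) + 1)) := by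
        refine (hMcard 0).trans ?_
        gcongr; linarith
      calc _ ≤ _ := (Nat.cast_le.2 (card_le_card hsub)).trans h1
        _ ≤ 2 * Real.exp (6 * D * ((0 : ℕ) + 1)) *
              (2 ^ Fintype.card κ * (2 * Real.exp (-A))) := by gcongr
        _ = 2 ^ Fintype.card κ * (2 * Real.exp (6 * D * ((0 : ℕ) + 1)) *
              (2 * Real.exp (-(A * (9 / 4) ^ 0)))) := by rw [pow_zero, mul_one]; ring
        _ ≤ 2 ^ Fintype.card κ * (δ / 2 * (1 / 2) ^ (0 + 3)) := by gcongr
        _ ≤ _ := by gcongr; norm_num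
    | succ k ih =>
      -- `π h` is a neighbour of `h` in the coarser net. The deviation at `h` is at most that at `π
      -- h` plus that of the link, whose variance proxy `4 * m * (1 / 4) ^ k` shrinks faster than
      -- the squared threshold; hence the growing factor `(9 / 4) ^ k`.
      choose! π hπM hπ using hMcov k
      set t := m * ε / 10 * (3 / 4) ^ k with ht
      have hsub : (univ.filter fun σ : κ → Bool => ∃ h ∈ M (k + 1),
          m * ε / 10 * (5 - 4 * (3 / 4) ^ (k + 1)) < |signedSum σ (pairDiff x h)|) ⊆
          (univ.filter fun σ : κ → Bool => ∃ h ∈ M k,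
            m * ε / 10 * (5 - 4 * (3 / 4) ^ k) < |signedSum σ (pairDiff x h)|) ∪
          (M (k + 1)).biUnion fun h => univ.filter fun σ : κ → Bool =>
            t < |signedSum σ (pairDiff x h - pairDiff x (π h))| := by
        intro σ hσ
        simp only [mem_filter, mem_univ, true_and, mem_biUnion, mem_union] at hσ ⊢
        obtain ⟨h, hh, h1⟩ := hσ
        by_contra! hcon
        have h2 := hcon.1 (π h) (hπM h (hM𝒜 _ hh))
        have h3 := hcon.2 h hh
        rw [signedSum_sub] at h3
        have h4 := abs_sub_abs_le_abs_sub (signedSum σ (pairDiff x h))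
          (signedSum σ (pairDiff x (π h)))
        rw [pow_succ] at h1
        rw [ht] at h3
        linarith
      have hone : ∀ h ∈ M (k + 1), ((univ.filter fun σ : κ → Bool =>
          t < |signedSum σ (pairDiff x h - pairDiff x (π h))|).card : ℝ) ≤
            2 ^ Fintype.card κ * (2 * Real.exp (-(A * (9 / 4) ^ k))) := by
        intro h hh
        have := card_lt_abs_signedSum_le (pairDiff x h - pairDiff x (π h))
          (V := 4 * m * (1 / 4) ^ k) (t := t)
          (by positivity) (by positivity) ((sum_pairDiff_sub_sq_le x h (π h)).trans
            (by linarith [hπ h (hM𝒜 _ hh)]))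
        have e : t ^ 2 / (2 * (4 * m * (1 / 4) ^ k)) = A * (9 / 4) ^ k := by
          have e9 : (9 / 4 : ℝ) ^ k * (1 / 4) ^ k = ((3 / 4) ^ k) ^ 2 := by
            rw [← mul_pow, ← pow_mul, mul_comm k 2, pow_mul]; norm_num
          rw [div_eq_iff (by positivity), ht, hA, mul_pow, ← e9]; field_simp; norm_num
        rwa [e] at this
      have h1 : (((M (k + 1)).biUnion fun h => univ.filter fun σ : κ → Bool =>
            t < |signedSum σ (pairDiff x h - pairDiff x (π h))|).card : ℝ) ≤
          (M (k + 1)).card * (2 ^ Fintype.card κ * (2 * Real.exp (-(A * (9 / 4) ^ k)))) :=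
        card_biUnion_le_card_mul_real _ _ hone
      have h2 := exp_chaining_bound hD0 hδ hδ1 hL hAL k
      -- The finer net has exponent `3 * D * (k + 2)`, which is why the bound carries 6 rather than
      -- 3.
      have h3 : ((M (k + 1)).card : ℝ) ≤ 2 * Real.exp (6 * D * (k + 1)) := by
        refine (hMcard (k + 1)).trans ?_
        have h0 : (0 : ℝ) ≤ k := by positivity
        have : 0 ≤ (D : ℝ) * k := by positivity
        gcongr ?_ * Real.exp ?_
        push_cast; linarith
      refine le_trans (le_of_eq (congrArg _ (congrArg card ?_))) <|
        (Nat.cast_le (α := ℝ).2 ((card_le_card hsub).trans (card_union_le _ _))).trans ?_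
      · ext; simp only [mem_filter]
      rw [Nat.cast_add]
      calc _ ≤ 2 ^ Fintype.card κ * (δ / 2 * (1 - (1 / 2) ^ (k + 1))) +
              2 * Real.exp (6 * D * (k + 1)) *
              (2 ^ Fintype.card κ * (2 * Real.exp (-(A * (9 / 4) ^ k)))) :=
            add_le_add ih (h1.trans (by gcongr))
        _ = 2 ^ Fintype.card κ * (δ / 2 * (1 - (1 / 2) ^ (k + 1)) +
              2 * Real.exp (6 * D * (k + 1)) * (2 * Real.exp (-(A * (9 / 4) ^ k)))) := by ring
        _ ≤ 2 ^ Fintype.card κ * (δ / 2 * (1 - (1 / 2) ^ (k + 1)) +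
              δ / 2 * (1 / 2) ^ (k + 3)) := by gcongr
        _ ≤ _ := by
            rw [← mul_add]
            gcongr
            have : (0 : ℝ) < (1 / 2) ^ k := by positivity
            simp only [pow_succ]
            linarith
  -- Once the scale is below one point, the net represents every trace exactly, so the chain ends
  -- without a remainder.
  obtain ⟨K, hK⟩ := exists_pow_lt_of_lt_one (x := 1 / (2 * m)) (by positivity)
    (show (1 / 4 : ℝ) < 1 by norm_num)
  rw [lt_div_iff₀ (by positivity)] at hK
  refine le_trans (Nat.cast_le.2 (card_le_card ?_)) ((hlevel K).trans ?_)
  · intro σ hσ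
    simp only [mem_filter, mem_univ, true_and] at hσ ⊢
    obtain ⟨h, hh, h1⟩ := hσ
    obtain ⟨h', hh', h2⟩ := hMcov K h hh
    refine ⟨h', hh', ?_⟩
    have h3 : (traceDiff z h h').card = 0 := by
      have : ((traceDiff z h h').card : ℝ) < (1 : ℕ) := by push_cast; exact h2.trans hK
      have := Nat.cast_lt.1 this
      omega
    have h4 : pairDiff x h = pairDiff x h' := by
      have h5 := sum_pairDiff_sub_sq_le x h h'
      rw [← hz, h3] at h5
      simp only [Nat.cast_zero, mul_zero] at h5
      have h6 := (sum_eq_zero_iff_of_nonneg fun i _ => sq_nonneg _).1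
        (le_antisymm h5 (sum_nonneg fun i _ => sq_nonneg _))
      ext i
      have := pow_eq_zero_iff (two_ne_zero) |>.1 (h6 i (mem_univ i))
      rw [Pi.sub_apply] at this
      linarith
    rw [← h4]
    refine lt_of_le_of_lt ?_ h1
    have : (0 : ℝ) < (3 / 4) ^ K := by positivity
    have : 0 < m * ε * (3 / 4) ^ K := by positivity
    linarith
  · gcongr
    have : (0 : ℝ) < (1 / 2) ^ (K + 1) := by positivity
    nlinarith

end Rademacher


/-! ### From signs to samples: symmetrization and uniform convergence. -/

section UniformConvergence

open Finset

variable {κ T : Type*} [Fintype κ] [DecidableEq T] [MeasurableSpace T]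
  [DiscreteMeasurableSpace T]

/-- The fraction of the points of the sample `S` lying in `h`. -/
noncomputable def empFreq {κ T : Type*} [Fintype κ] [DecidableEq T] (S : κ → T)
    (h : Finset T) : ℝ :=
  ((univ.filter fun i => S i ∈ h).card : ℝ) / Fintype.card κ

lemma sum_pairDiff {κ T : Type*} [Fintype κ] [DecidableEq T] [Nonempty κ] (x : κ → T × T)
    (h : Finset T) :
    ∑ i, pairDiff x h i =
      Fintype.card κ * (empFreq (fun i => (x i).1) h - empFreq (fun i => (x i).2) h) := by
  have : (Fintype.card κ : ℝ) ≠ 0 := by exact_mod_cast Fintype.card_ne_zero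
  simp only [pairDiff, empFreq, sum_sub_distrib, card_filter]
  push_cast
  field_simp

/-- Chebyshev's inequality for the empirical frequency of a set. -/
lemma measure_le_abs_empFreq_sub_le [Nonempty κ] (μ : Measure T) [IsProbabilityMeasure μ]
    (h : Finset T) {ε : ℝ} (hε : 0 < ε) (hm : 2 ≤ Fintype.card κ * ε ^ 2) :
    (Measure.pi fun _ : κ => μ) {S | ε / 2 ≤ |empFreq S h - μ.real h|} ≤ 1 / 2 := by
  set m : ℝ := (Fintype.card κ : ℝ) with hmdef
  have hm0 : 0 < m := by rw [hmdef]; exact_mod_cast Fintype.card_pos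
  set f : T → ℝ := fun t => if t ∈ h then 1 else 0 with hf
  have hfL : MemLp f 2 μ := by
    refine MemLp.of_bound (Measurable.of_discrete.aestronglyMeasurable) 1 (ae_of_all _ fun t => ?_)
    simp only [hf]; split_ifs <;> simp
  set Y : (κ → T) → ℝ := ∑ i : κ, fun S : κ → T => f (S i) with hY
  have hYL : MemLp Y 2 (Measure.pi fun _ : κ => μ) :=
    memLp_finsetSum' _ fun i _ => hfL.comp_measurePreserving (measurePreserving_eval _ i)
  have hint : ∫ t, f t ∂μ = μ.real h := by
    have : f = (h : Set T).indicator 1 := by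
      ext t; simp [hf, Set.indicator_apply]
    rw [this, integral_indicator_one (MeasurableSet.of_discrete)]
  have hmean : (∫ S, Y S ∂(Measure.pi fun _ : κ => μ)) = m * μ.real h := by
    simp only [hY, Finset.sum_apply]
    rw [integral_finsetSum]
    · have : ∀ i : κ, ∫ S : κ → T, f (S i) ∂(Measure.pi fun _ : κ => μ) = μ.real h := by
        intro i
        rw [← hint]
        conv_rhs => rw [← (measurePreserving_eval (fun _ : κ => μ) i).map_eq]
        rw [integral_map (measurable_pi_apply i).aemeasurable
          Measurable.of_discrete.aestronglyMeasurable]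
      simp [this, hmdef]
    · intro i _
      exact (hfL.comp_measurePreserving (measurePreserving_eval _ i)).integrable (by norm_num)
  have hvar : variance Y (Measure.pi fun _ : κ => μ) ≤ m / 4 := by
    rw [hY, variance_sum_pi fun _ => hfL]
    have : variance f μ ≤ ((1 - 0) / 2) ^ 2 := by
      refine variance_le_sq_of_bounded (ae_of_all _ fun t => ?_) Measurable.of_discrete.aemeasurable
      simp only [hf]; split_ifs <;> simp
    rw [sum_const, nsmul_eq_mul, card_univ, ← hmdef]
    nlinarith
  have hset : {S : κ → T | ε / 2 ≤ |empFreq S h - μ.real h|} =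
      {S | m * ε / 2 ≤ |Y S - ∫ S, Y S ∂(Measure.pi fun _ : κ => μ)|} := by
    ext S
    have e1 : empFreq S h = Y S / m := by
      rw [empFreq, card_filter]
      simp only [hY, hf, Finset.sum_apply, Nat.cast_sum, Nat.cast_ite, Nat.cast_one, Nat.cast_zero]
      rfl
    rw [Set.mem_ofPred_eq, Set.mem_ofPred_eq, hmean]
    have e2 : Y S - m * μ.real h = m * (empFreq S h - μ.real h) := by
      rw [e1]; field_simp
    rw [e2, abs_mul, abs_of_pos hm0, mul_div_assoc, mul_le_mul_iff_right₀ hm0]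
  rw [hset]
  refine (meas_ge_le_variance_div_sq hYL (by positivity)).trans ?_
  rw [show (1 / 2 : ENNReal) = ENNReal.ofReal (1 / 2) by
    rw [ENNReal.ofReal_div_of_pos (by norm_num)]; simp]
  refine ENNReal.ofReal_le_ofReal ?_
  rw [div_le_iff₀ (by positivity)]
  nlinarith

/-- Symmetrization with a ghost sample. -/
lemma measure_exists_lt_abs_empFreq_sub_le [Finite T] [Nonempty κ] (μ : Measure T)
    [IsProbabilityMeasure μ] (𝒜 : Finset (Finset T)) {ε : ℝ} (hε : 0 < ε) (hm : 2 ≤ Fintype.card κ * ε ^ 2) :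
    (Measure.pi fun _ : κ => μ) {S | ∃ h ∈ 𝒜, ε < |empFreq S h - μ.real h|} ≤
      2 * ((Measure.pi fun _ : κ => μ).prod (Measure.pi fun _ : κ => μ))
        {p | ∃ h ∈ 𝒜, ε / 2 < |empFreq p.1 h - empFreq p.2 h|} := by
  set ν := Measure.pi fun _ : κ => μ with hν
  rw [Measure.prod_apply MeasurableSet.of_discrete]
  set B := {S : κ → T | ∃ h ∈ 𝒜, ε < |empFreq S h - μ.real h|} with hB
  have h1 : ∫⁻ S, B.indicator (fun _ => (1 / 2 : ENNReal)) S ∂ν ≤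
      ∫⁻ S, ν (Prod.mk S ⁻¹' {p | ∃ h ∈ 𝒜, ε / 2 < |empFreq p.1 h - empFreq p.2 h|}) ∂ν := by
    refine lintegral_mono fun S => ?_
    by_cases hS : S ∈ B
    · rw [Set.indicator_of_mem hS]
      obtain ⟨h, hh, hSh⟩ := hS
      have h2 := measure_le_abs_empFreq_sub_le (κ := κ) μ h hε hm
      rw [← hν] at h2
      -- The witness `h` depends on `S` only, so Chebyshev for this single set applies to the ghost
      -- sample `S'`.
      have h3 : ({S' : κ → T | ε / 2 ≤ |empFreq S' h - μ.real h|})ᶜ ⊆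
          Prod.mk S ⁻¹' {p | ∃ h ∈ 𝒜, ε / 2 < |empFreq p.1 h - empFreq p.2 h|} := by
        intro S' hS'
        simp only [Set.mem_compl_iff, Set.mem_ofPred_eq, not_le] at hS'
        refine ⟨h, hh, ?_⟩
        have h4 := abs_sub_le (empFreq S h) (empFreq S' h) (μ.real h)
        change ε / 2 < |empFreq S h - empFreq S' h|
        linarith
      refine le_trans ?_ (measure_mono h3)
      rw [prob_compl_eq_one_sub MeasurableSet.of_discrete]
      refine le_trans ?_ (tsub_le_tsub_left h2 1)
      simp
    · rw [Set.indicator_of_notMem hS]; exact zero_le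
  rw [lintegral_indicator_const MeasurableSet.of_discrete] at h1
  calc ν B = 2 * (1 / 2 * ν B) := by
        rw [← mul_assoc, one_div, ENNReal.mul_inv_cancel (by norm_num) (by norm_num), one_mul]
    _ ≤ _ := by gcongr

/-- Swapping the two entries of any of the pairs preserves the law of the double sample, so the
probability equals its average over all swaps. Under the integral, with the double sample fixed,
that average is the proportion of sign vectors bounded by chaining. -/
lemma prod_measure_le_of_signedSum [Finite T] [DecidableEq κ] [Nonempty κ] (μ : Measure T)
    [IsProbabilityMeasure μ]
    (𝒜 : Finset (Finset T)) {ε δ : ℝ} (hε : 0 < ε) (hδ : 0 < δ) (hδ1 : δ < 1)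
    (hm : 9600 * ((𝒜.vcDim : ℝ) + Real.log (2 / δ)) ≤ Fintype.card κ * ε ^ 2) :
    ((Measure.pi fun _ : κ => μ).prod (Measure.pi fun _ : κ => μ))
        {p | ∃ h ∈ 𝒜, ε / 2 < |empFreq p.1 h - empFreq p.2 h|} ≤ ENNReal.ofReal (δ / 2) := by
  classical
  have hm0 : (0 : ℝ) < Fintype.card κ := by exact_mod_cast Fintype.card_pos
  set ν₂ := Measure.pi fun _ : κ => μ.prod μ with hν₂
  set E : Set (κ → T × T) :=
    {x | ∃ h ∈ 𝒜, Fintype.card κ * ε / 2 < |∑ i, pairDiff x h i|} with hE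
  have hprod : ((Measure.pi fun _ : κ => μ).prod (Measure.pi fun _ : κ => μ))
        {p | ∃ h ∈ 𝒜, ε / 2 < |empFreq p.1 h - empFreq p.2 h|} = ν₂ E := by
    rw [← (measurePreserving_arrowProdEquivProdArrow T T κ (fun _ => μ) (fun _ => μ)).map_eq,
      Measure.map_apply (MeasurableEquiv.measurable _) MeasurableSet.of_discrete]
    congr 1
    ext x
    simp only [hE, Set.mem_preimage, Set.mem_ofPred_eq]
    refine exists_congr fun h => and_congr_right fun _ => ?_
    rw [sum_pairDiff, abs_mul, abs_of_pos hm0, mul_div_assoc, mul_lt_mul_iff_right₀ hm0]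
    rfl
  set flip : (κ → Bool) → (κ → T × T) → (κ → T × T) :=
    fun σ x i => (if σ i then id else Prod.swap) (x i) with hflip
  have hflipsum : ∀ σ x h, ∑ i, pairDiff (flip σ x) h i = signedSum σ (pairDiff x h) := by
    intro σ x h
    refine sum_congr rfl fun i _ => ?_
    by_cases hσ : σ i = true <;> simp [pairDiff, hflip, hσ]
  have hinv : ∀ σ, ν₂ (flip σ ⁻¹' E) = ν₂ E := by
    intro σ
    refine (measurePreserving_pi (fun _ : κ => μ.prod μ) (fun _ : κ => μ.prod μ)
      (f := fun i => if σ i then id else Prod.swap) fun i => ?_).measure_preimage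
        MeasurableSet.of_discrete.nullMeasurableSet
    split_ifs
    · exact MeasurePreserving.id _
    · exact Measure.measurePreserving_swap
  have hpt : ∀ x, ∑ σ : κ → Bool, (flip σ ⁻¹' E).indicator (fun _ => (1 : ENNReal)) x ≤
      2 ^ Fintype.card κ * ENNReal.ofReal (δ / 2) := by
    intro x
    have h1 := card_exists_lt_abs_signedSum_le x 𝒜 hε hδ hδ1 hm
    have h2 : ∑ σ : κ → Bool, (flip σ ⁻¹' E).indicator (fun _ => (1 : ENNReal)) x =
        ((univ.filter fun σ : κ → Bool =>
          ∃ h ∈ 𝒜, Fintype.card κ * ε / 2 < |signedSum σ (pairDiff x h)|).card : ENNReal) := by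
      rw [card_filter]
      push_cast
      refine sum_congr rfl fun σ _ => ?_
      rw [Set.indicator_apply]
      simp only [Set.mem_preimage, hE, Set.mem_ofPred_eq, hflipsum]
    rw [h2, ← ENNReal.ofReal_natCast]
    refine (ENNReal.ofReal_le_ofReal h1).trans (le_of_eq ?_)
    rw [ENNReal.ofReal_mul (by positivity), ENNReal.ofReal_pow (by norm_num)]
    simp
  have hsum : (2 : ENNReal) ^ Fintype.card κ * ν₂ E ≤
      2 ^ Fintype.card κ * ENNReal.ofReal (δ / 2) := by
    calc (2 : ENNReal) ^ Fintype.card κ * ν₂ E = ∑ σ : κ → Bool, ν₂ (flip σ ⁻¹' E) := by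
          simp [hinv]
      _ = ∫⁻ x, ∑ σ : κ → Bool, (flip σ ⁻¹' E).indicator (fun _ => (1 : ENNReal)) x ∂ν₂ := by
          rw [lintegral_finsetSum _ fun _ _ => Measurable.of_discrete]
          refine sum_congr rfl fun σ _ => ?_
          rw [lintegral_indicator_const MeasurableSet.of_discrete, one_mul]
      _ ≤ ∫⁻ _, 2 ^ Fintype.card κ * ENNReal.ofReal (δ / 2) ∂ν₂ := lintegral_mono hpt
      _ = _ := by simp
  rw [hprod]
  exact (ENNReal.mul_le_mul_iff_right (by positivity) (by finiteness)).1 hsum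

/-- **Uniform convergence** of empirical frequencies over a VC class at the optimal rate. -/
theorem measure_exists_lt_abs_empFreq_sub_le_of_card [Finite T] (μ : Measure T)
    [IsProbabilityMeasure μ]
    (𝒜 : Finset (Finset T)) {ε δ : ℝ} (hε : 0 < ε) (hδ : 0 < δ) (hδ1 : δ < 1)
    (hm : 9600 * ((𝒜.vcDim : ℝ) + Real.log (2 / δ)) ≤ Fintype.card κ * ε ^ 2) :
    (Measure.pi fun _ : κ => μ) {S | ∃ h ∈ 𝒜, ε < |empFreq S h - μ.real h|} ≤
      ENNReal.ofReal δ := by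
  classical
  have hlog2 : Real.log 2 ≤ Real.log (2 / δ) := by
    apply Real.log_le_log (by norm_num)
    rw [le_div_iff₀ hδ]; linarith
  have hl2 := Real.log_two_gt_d9
  have hD : (0 : ℝ) ≤ 𝒜.vcDim := by positivity
  -- The term `log (2 / δ) ≥ log 2` alone gives this; it serves Chebyshev and also excludes an empty
  -- sample.
  have hm2 : 2 ≤ Fintype.card κ * ε ^ 2 := by linarith
  have : Nonempty κ := by
    rw [← Fintype.card_pos_iff, Nat.pos_iff_ne_zero]
    intro h
    rw [h] at hm2
    norm_num at hm2
  refine (measure_exists_lt_abs_empFreq_sub_le μ 𝒜 hε hm2).trans ?_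
  refine (mul_le_mul_right (prod_measure_le_of_signedSum μ 𝒜 hε hδ hδ1 hm) 2).trans (le_of_eq ?_)
  rw [show (2 : ENNReal) = ENNReal.ofReal 2 by simp, ← ENNReal.ofReal_mul (by norm_num)]
  congr 1; ring

end UniformConvergence


/-! ### Rejection sampling. -/

section Sampler

variable {T : Type*}

/-- The event that the first `n` trials are rejected and the next one lies in `B`. -/
def acceptedAt (A B : Set T) (n : ℕ) : Set (ℕ → T) :=
  {ω | (∀ i < n, ω i ∉ A) ∧ ω n ∈ B}

lemma acceptedAt_eq_pi (A B : Set T) (n : ℕ) :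
    acceptedAt A B n =
      Set.pi (Finset.range (n + 1) : Finset ℕ) fun i => if i < n then Aᶜ else B := by
  ext ω
  simp only [acceptedAt, Set.mem_ofPred_eq, Set.mem_pi, Finset.coe_range, Set.mem_Iio]
  constructor
  · rintro ⟨h1, h2⟩ i hi
    split_ifs with h
    · exact h1 i h
    · rwa [show i = n by omega]
  · intro h
    refine ⟨fun i hi => ?_, ?_⟩
    · have := h i (by omega)
      rwa [if_pos hi] at this
    · have := h n (by omega)
      rwa [if_neg (lt_irrefl n)] at this

lemma measurableSet_acceptedAt [MeasurableSpace T] {A B : Set T} (hA : MeasurableSet A) (hB : MeasurableSet B)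
    (n : ℕ) : MeasurableSet (acceptedAt A B n) := by
  rw [acceptedAt_eq_pi]
  refine MeasurableSet.pi (Finset.countable_toSet _) fun i _ => ?_
  split_ifs
  exacts [hA.compl, hB]

lemma infinitePi_acceptedAt [MeasurableSpace T] (μ : Measure T) [IsProbabilityMeasure μ] {A B : Set T}
    (hA : MeasurableSet A) (hB : MeasurableSet B) (n : ℕ) :
    (Measure.infinitePi fun _ : ℕ => μ) (acceptedAt A B n) = μ Aᶜ ^ n * μ B := by
  rw [acceptedAt_eq_pi, Measure.infinitePi_pi, Finset.prod_range_succ]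
  · rw [Finset.prod_congr rfl (g := fun _ => μ Aᶜ) fun i hi => by
      rw [if_pos (Finset.mem_range.1 hi)]]
    simp
  · intro i _
    split_ifs
    exacts [hA.compl, hB]

lemma firstAccepted_eq_some_mem_iff {A B : Set T} (hBA : B ⊆ A) (ω : ℕ → T) :
    (∃ t ∈ B, firstAccepted (· ∈ A) ω = some t) ↔ ∃ n, ω ∈ acceptedAt A B n := by
  classical
  constructor
  · rintro ⟨t, ht, h⟩
    unfold firstAccepted at h
    split_ifs at h with hex
    refine ⟨Nat.find hex, fun i hi => Nat.find_min hex hi, ?_⟩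
    rw [Option.some.injEq] at h
    convert ht
  · rintro ⟨n, hn, hB⟩
    have hex : ∃ n, ω n ∈ A := ⟨n, hBA hB⟩
    have hfind : Nat.find hex = n := by
      rw [Nat.find_eq_iff]
      exact ⟨hBA hB, hn⟩
    refine ⟨ω n, hB, ?_⟩
    unfold firstAccepted
    rw [dif_pos hex]
    congr 2

/-- Splitting by the time of acceptance gives disjoint cylinders and the geometric series of `μ Aᶜ ^
n * μ B`. -/
lemma infinitePi_firstAccepted_mem [MeasurableSpace T] (μ : Measure T) [IsProbabilityMeasure μ] {A B : Set T}
    (hA : MeasurableSet A) (hB : MeasurableSet B) (hBA : B ⊆ A) :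
    (Measure.infinitePi fun _ : ℕ => μ) {ω | ∃ t ∈ B, firstAccepted (· ∈ A) ω = some t} =
      (μ A)⁻¹ * μ B := by
  have hset : {ω | ∃ t ∈ B, firstAccepted (· ∈ A) ω = some t} = ⋃ n, acceptedAt A B n := by
    ext ω
    rw [Set.mem_ofPred_eq, firstAccepted_eq_some_mem_iff hBA, Set.mem_iUnion]
  rw [hset, measure_iUnion]
  · simp_rw [infinitePi_acceptedAt μ hA hB]
    rw [ENNReal.tsum_mul_right, ENNReal.tsum_geometric, prob_compl_eq_one_sub hA,
      ENNReal.sub_sub_cancel ENNReal.one_ne_top prob_le_one]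
  · intro i j hij
    rw [Function.onFun, Set.disjoint_left]
    rintro ω ⟨h1, h2⟩ ⟨h3, h4⟩
    rcases lt_or_gt_of_ne hij with h | h
    · exact h3 i h (hBA h2)
    · exact h1 j h (hBA h4)
  · exact measurableSet_acceptedAt hA hB

lemma measurableSet_firstAccepted_mem [MeasurableSpace T] {A B : Set T}
    (hA : MeasurableSet A) (hB : MeasurableSet B) (hBA : B ⊆ A) :
    MeasurableSet {ω : ℕ → T | ∃ t ∈ B, firstAccepted (· ∈ A) ω = some t} := by
  have hset : {ω | ∃ t ∈ B, firstAccepted (· ∈ A) ω = some t} = ⋃ n, acceptedAt A B n := by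
    ext ω
    rw [Set.mem_ofPred_eq, firstAccepted_eq_some_mem_iff hBA, Set.mem_iUnion]
  rw [hset]
  exact MeasurableSet.iUnion fun n => measurableSet_acceptedAt hA hB n

lemma firstAccepted_mem {A : Set T} {ω : ℕ → T} {t : T}
    (h : firstAccepted (· ∈ A) ω = some t) : t ∈ A := by
  classical
  unfold firstAccepted at h
  split_ifs at h with hex
  rw [Option.some.injEq] at h
  rw [← h]
  exact Nat.find_spec hex

/-- Rejection sampling terminates almost surely. -/
lemma ae_exists_firstAccepted [MeasurableSpace T] (μ : Measure T) [IsProbabilityMeasure μ] {A : Set T}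
    (hA : MeasurableSet A) (hA0 : μ A ≠ 0) :
    ∀ᵐ ω ∂(Measure.infinitePi fun _ : ℕ => μ), ∃ t, firstAccepted (· ∈ A) ω = some t := by
  have h1 := infinitePi_firstAccepted_mem μ hA hA subset_rfl
  rw [ENNReal.inv_mul_cancel hA0 (measure_ne_top _ _)] at h1
  have h2 := (prob_compl_eq_zero_iff
    (measurableSet_firstAccepted_mem hA hA subset_rfl)).2 h1
  rw [ae_iff]
  refine measure_mono_null ?_ h2
  intro ω hω ⟨t, _, ht⟩
  exact hω ⟨t, ht⟩

/-- The output of rejection sampling, with a default value if the loop does not terminate. -/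
noncomputable def sampleOutput (A : Set T) (t₀ : T) (ω : ℕ → T) : T :=
  (firstAccepted (· ∈ A) ω).getD t₀

/-- The second part is the contribution of the default value on nonterminating runs: it matters for
measurability and is null when `μ A ≠ 0`. -/
lemma sampleOutput_preimage (A : Set T) (t₀ : T) (B : Set T) :
    sampleOutput A t₀ ⁻¹' B =
      {ω | ∃ t ∈ B ∩ A, firstAccepted (· ∈ A) ω = some t} ∪
        ({ω | ∃ t ∈ A, firstAccepted (· ∈ A) ω = some t}ᶜ ∩ {_ω | t₀ ∈ B}) := by
  ext ω
  simp only [Set.mem_preimage, sampleOutput, Set.mem_union, Set.mem_inter_iff, Set.mem_compl_iff,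
    Set.mem_ofPred_eq]
  cases h : firstAccepted (· ∈ A) ω with
  | none => simp
  | some t => simp [firstAccepted_mem h]

lemma measurable_sampleOutput [MeasurableSpace T] {A : Set T} (hA : MeasurableSet A) (t₀ : T) :
    Measurable (sampleOutput A t₀) := by
  intro B hB
  rw [sampleOutput_preimage]
  refine (measurableSet_firstAccepted_mem hA (hB.inter hA) Set.inter_subset_right).union
    ((measurableSet_firstAccepted_mem hA hA subset_rfl).compl.inter ?_)
  exact MeasurableSet.const _

/-- The output of rejection sampling follows the conditional law. -/
lemma map_sampleOutput [MeasurableSpace T] (μ : Measure T) [IsProbabilityMeasure μ] {A : Set T}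
    (hA : MeasurableSet A) (hA0 : μ A ≠ 0) (t₀ : T) :
    (Measure.infinitePi fun _ : ℕ => μ).map (sampleOutput A t₀) = μ[|A] := by
  ext B hB
  rw [Measure.map_apply (measurable_sampleOutput hA t₀) hB, cond_apply hA, sampleOutput_preimage,
    measure_congr (union_ae_eq_left_of_ae_eq_empty (ae_eq_empty.2 ?_)),
    infinitePi_firstAccepted_mem μ hA (hB.inter hA) Set.inter_subset_right, Set.inter_comm]
  refine measure_mono_null ?_ (ae_iff.1 (ae_exists_firstAccepted μ hA hA0))
  rintro ω ⟨h1, _⟩ ⟨t, ht⟩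
  exact h1 ⟨t, firstAccepted_mem ht, ht⟩

/-- Independent runs of a rejection sampler terminate and avoid any event that is unlikely for
independent draws from the conditional law. -/
lemma pi_infinitePi_not_exists_le {κ : Type*} [Fintype κ] [MeasurableSpace T]
    (μ : Measure T) [IsProbabilityMeasure μ]
    {A : Set T} (hA : MeasurableSet A) (hA0 : μ A ≠ 0) {bad : Set (κ → T)}
    (hbad : MeasurableSet bad) :
    (Measure.pi fun _ : κ => Measure.infinitePi fun _ : ℕ => μ)
        {ω | ¬ ∃ S : κ → T, (∀ i, firstAccepted (· ∈ A) (ω i) = some (S i)) ∧ S ∉ bad} ≤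
      (Measure.pi fun _ : κ => μ[|A]) bad := by
  obtain ⟨t₀, -⟩ : A.Nonempty := by
    rw [Set.nonempty_iff_ne_empty]; rintro rfl; simp at hA0
  set Q := Measure.infinitePi fun _ : ℕ => μ with hQ
  have hmeas : Measurable fun (ω : κ → ℕ → T) i => sampleOutput A t₀ (ω i) :=
    measurable_pi_lambda _ fun i =>
      (measurable_sampleOutput hA t₀).comp (measurable_pi_apply i)
  have : IsProbabilityMeasure (μ[|A]) := cond_isProbabilityMeasure hA0
  have hmap : (Measure.pi fun _ : κ => Q).map (fun ω i => sampleOutput A t₀ (ω i)) =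
      Measure.pi fun _ : κ => μ[|A] :=
    (measurePreserving_pi (fun _ : κ => Q) (fun _ : κ => μ[|A])
      fun _ => ⟨measurable_sampleOutput hA t₀, map_sampleOutput μ hA hA0 t₀⟩).map_eq
  have hnull : (Measure.pi fun _ : κ => Q)
      {ω | ¬ ∀ i, ∃ t, firstAccepted (· ∈ A) (ω i) = some t} = 0 := by
    rw [← ae_iff, ae_all_iff]
    intro i
    exact (Measure.tendsto_eval_ae_ae (μ := fun _ : κ => Q) (i := i)).eventually
      (ae_exists_firstAccepted μ hA hA0)
  rw [← hmap, Measure.map_apply hmeas hbad]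
  refine (measure_mono (t := {ω | ¬ ∀ i, ∃ t, firstAccepted (· ∈ A) (ω i) = some t} ∪
    (fun (ω : κ → ℕ → T) i => sampleOutput A t₀ (ω i)) ⁻¹' bad) ?_).trans
      ((measure_union_le _ _).trans (by rw [hnull, zero_add]))
  intro ω hω
  by_contra hcon
  simp only [Set.mem_union, Set.mem_ofPred_eq, not_or, not_not] at hcon
  obtain ⟨h1, h2⟩ := hcon
  choose S hS using h1
  refine hω ⟨S, hS, ?_⟩
  have : S = fun i => sampleOutput A t₀ (ω i) := by
    ext i
    rw [sampleOutput, hS, Option.getD_some]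
  rw [this]
  exact h2

end Sampler

/-! ### The laws of the samplers and the cost of seeing only close pairs. -/

section Laws

open Finset

variable {X : Type*} [Fintype X] [MeasurableSpace X] [DiscreteMeasurableSpace X]

/-- The ordered pairs of distinct points at distance at most `lam`. -/
def closePairs {X : Type*} (d : X → X → ℝ) (lam : ℝ) : Set (X × X) :=
  {p | p.1 ≠ p.2 ∧ d p.1 p.2 ≤ lam}

/-- The weight `|S_x|` of the first point cancels the density `1 / |S_x|` of the second. A point
without neighbours contributes zero on both sides. -/
lemma posTrial_eq_uniformOn (d : X → X → ℝ) (lam : ℝ) :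
    posTrial d lam = uniformOn (closePairs d lam) := by
  classical
  ext B hB
  have hfin : ∀ x, uniformOn (nbrs d lam x : Set X) (Prod.mk x ⁻¹' B) =
      ((nbrs d lam x ∩ univ.filter fun y => (x, y) ∈ B).card : ENNReal) /
        (nbrs d lam x).card := by
    intro x
    rw [← uniformOn_apply_finset]
    congr 1
    ext y; simp
  have hmul : ∀ x, ((nbrs d lam x).card : ENNReal) *
      uniformOn (nbrs d lam x : Set X) (Prod.mk x ⁻¹' B) =
        ((nbrs d lam x ∩ univ.filter fun y => (x, y) ∈ B).card : ENNReal) := by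
    intro x
    rw [hfin]
    by_cases h0 : (nbrs d lam x).card = 0
    · rw [card_eq_zero.1 h0]; simp
    · exact ENNReal.mul_div_cancel (by exact_mod_cast h0) (by simp)
  set D : Finset (X × X) := univ.filter fun p => p.1 ≠ p.2 ∧ d p.1 p.2 ≤ lam with hD
  have hDset : closePairs d lam = (D : Set (X × X)) := by ext p; simp [closePairs, hD]
  have hDcard : (∑ x : X, ((nbrs d lam x).card : ENNReal)) = (D.card : ENNReal) := by
    rw [hD, card_filter, Fintype.sum_prod_type]
    push_cast
    refine sum_congr rfl fun x _ => ?_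
    rw [nbrs, card_filter]
    push_cast
    exact sum_congr rfl fun y _ => by simp only [ne_comm (a := y)]
  have hDB : (∑ x : X, ((nbrs d lam x ∩ univ.filter fun y => (x, y) ∈ B).card : ENNReal)) =
      ((D ∩ univ.filter fun p => p ∈ B).card : ENNReal) := by
    rw [hD, ← filter_and, card_filter, Fintype.sum_prod_type]
    push_cast
    refine sum_congr rfl fun x _ => ?_
    rw [nbrs, ← filter_and, card_filter]
    push_cast
    exact sum_congr rfl fun y _ => by simp only [ne_comm (a := y)]
  have hBset : B = ((univ.filter fun p => p ∈ B : Finset (X × X)) : Set (X × X)) := by ext p; simp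
  rw [posTrial, Measure.bind_apply hB Measurable.of_discrete.aemeasurable, lintegral_smul_measure,
    lintegral_finsetSum_measure]
  simp_rw [lintegral_smul_measure, lintegral_dirac]
  simp_rw [Measure.map_apply (measurable_prodMk_left) hB, smul_eq_mul, hmul]
  rw [hDcard, hDB, hDset, hBset, uniformOn_apply_finset, ENNReal.div_eq_inv_mul]
  simp

lemma cond_uniformOn {T : Type*} [Finite T] [MeasurableSpace T] [DiscreteMeasurableSpace T]
    (s t : Set T) : (uniformOn s)[|t] = uniformOn (s ∩ t) := by
  rw [uniformOn, uniformOn, cond_cond_eq_cond_inter' MeasurableSet.of_discrete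
    MeasurableSet.of_discrete]
  exact (Measure.count_apply_lt_top.2 (Set.toFinite s)).ne

/-- The uniform laws on a set and on a subset of large relative measure are close. -/
lemma abs_uniformOn_sub_uniformOn_le {T : Type*} [Finite T] [MeasurableSpace T]
    [DiscreteMeasurableSpace T] {G A : Set T} (hGA : G ⊆ A) (hG : G.Nonempty) {α : ℝ}
    (hα : (uniformOn A).real (A \ G) ≤ α) (E : Set T) :
    |(uniformOn G).real E - (uniformOn A).real E| ≤ α := by
  have hA : A.Nonempty := hG.mono hGA
  have : IsProbabilityMeasure (uniformOn A) := isProbabilityMeasure_uniformOn A.toFinite hA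
  set μ := uniformOn A with hμ
  have hGcond : uniformOn G = μ[|G] := by
    rw [hμ, cond_uniformOn, Set.inter_eq_right.2 hGA]
  have hA1 : μ.real A = 1 := by
    rw [measureReal_def, hμ, uniformOn_self A.toFinite hA]; rfl
  have hGpos : 0 < μ.real G := by
    rw [measureReal_def, ENNReal.toReal_pos_iff]
    refine ⟨pos_iff_ne_zero.2 fun h => ?_, measure_lt_top _ _⟩
    rw [hμ, uniformOn_eq_zero_iff A.toFinite, Set.inter_eq_right.2 hGA] at h
    exact hG.ne_empty h
  have hG1 : 1 - μ.real G ≤ α := by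
    rw [measureReal_sdiff hGA MeasurableSet.of_discrete] at hα
    linarith
  have hE : (uniformOn G).real E = (μ.real G)⁻¹ * μ.real (G ∩ E) := by
    rw [hGcond, measureReal_def, cond_apply MeasurableSet.of_discrete, ENNReal.toReal_mul,
      ENNReal.toReal_inv]
    rfl
  have h1 : μ.real E ≤ μ.real (G ∩ E) + (1 - μ.real G) := by
    have h2 : μ.real E = μ.real (E ∩ G) + μ.real (E \ G) :=
      (measureReal_inter_add_sdiff MeasurableSet.of_discrete).symm
    have h3 : μ.real (E \ G) ≤ μ.real Gᶜ := measureReal_mono fun _ h => h.2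
    rw [probReal_compl_eq_one_sub MeasurableSet.of_discrete] at h3
    rw [Set.inter_comm] at h2
    linarith
  have h4 : μ.real (G ∩ E) ≤ μ.real G := measureReal_mono Set.inter_subset_left
  have h5 : μ.real (G ∩ E) ≤ μ.real E := measureReal_mono Set.inter_subset_right
  have h6 : μ.real G ≤ 1 := measureReal_le_one
  have h7 : 0 ≤ μ.real (G ∩ E) := measureReal_nonneg
  set u := (uniformOn G).real E with hu
  have h8 : u * μ.real G = μ.real (G ∩ E) := by rw [hE]; field_simp
  have h9 : u ≤ 1 := by
    rw [hE, inv_mul_le_iff₀ hGpos]; linarith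
  have h10 : 0 ≤ u := by rw [hE]; positivity
  -- With `g = μ.real G`, `h8` together with `h5` and `h1` gives `u * g ≤ μ.real E ≤ u * g + (1 -
  -- g)`; as `0 ≤ u ≤ 1`, both differences are at most `1 - g ≤ α`.
  rw [abs_le]
  constructor <;> nlinarith

end Laws


/-! ### Clusterings as set families, and the deterministic analysis of ERM. -/

section Labels

open Finset

variable {X : Type*} [Fintype X]

lemma label_diag (C : Clustering X) (x : X) : label C (x, x) = 1 := by
  classical
  obtain ⟨s, hs, hx⟩ := C.exists_mem (mem_univ x)
  exact if_pos ⟨s, hs, hx, hx⟩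

open scoped Classical in
/-- The set of all pairs, including the diagonal ones, labelled `1` by `C`. -/
noncomputable def sameSet (C : Clustering X) : Finset (X × X) :=
  univ.filter fun p => label C p = 1

open scoped Classical in
/-- Adding the diagonal to all sets of the class does not increase the VC-dimension. -/
lemma vcDim_image_sameSet_le (F : Finset (Clustering X)) :
    (F.image sameSet).vcDim ≤ vcDim F := by
  refine Finset.sup_le fun s hs => ?_
  rw [mem_shatterer] at hs
  refine Shatters.card_le_vcDim fun t ht => ?_
  obtain ⟨u, hu, rfl⟩ := hs ht
  obtain ⟨C, hC, rfl⟩ := mem_image.1 hu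
  refine ⟨_, mem_image_of_mem _ hC, ?_⟩
  ext p
  simp only [mem_inter, mem_filter, mem_univ, true_and, sameSet]
  -- A diagonal pair lies in every `sameSet`, so it cannot belong to a shattered set: the empty
  -- trace would not be realized.
  refine and_congr_right fun hp => and_iff_right ?_
  intro heq
  obtain ⟨v, hv, hsv⟩ := hs (empty_subset s)
  obtain ⟨C', -, rfl⟩ := mem_image.1 hv
  have : p ∈ s ∩ sameSet C' := by
    obtain ⟨x, y⟩ := p
    obtain rfl : x = y := heq
    simp [hp, sameSet, label_diag]
  rw [hsv] at this
  exact notMem_empty _ this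

lemma label_ne_one_iff (C : Clustering X) (p : X × X) : ¬ label C p = 1 ↔ label C p = 0 := by
  have : ∀ a : Fin 2, ¬ a = 1 ↔ a = 0 := by decide
  exact this _

open scoped Classical in
lemma sampleFreq_one_eq {m : ℕ} (S : Fin m → X × X) (C : Clustering X) :
    sampleFreq S C 1 = empFreq S (sameSet C) := by
  simp [sampleFreq, empFreq, sameSet]

lemma sampleFreq_zero_eq {m : ℕ} (hm : m ≠ 0) (S : Fin m → X × X) (C : Clustering X) :
    sampleFreq S C 0 = 1 - sampleFreq S C 1 := by
  classical
  have h := card_filter_add_card_filter_not (s := (univ : Finset (Fin m)))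
    (fun i => label C (S i) = 1)
  simp only [label_ne_one_iff, card_univ, Fintype.card_fin] at h
  have hm' : (m : ℝ) ≠ 0 := by exact_mod_cast hm
  have h' : ((univ.filter fun i => label C (S i) = 1).card : ℝ) +
      (univ.filter fun i => label C (S i) = 0).card = m := by exact_mod_cast h
  rw [sampleFreq, sampleFreq, eq_sub_iff_add_eq, ← add_div, add_comm, div_eq_one_iff_eq hm']
  convert h'

variable [MeasurableSpace X]

lemma real_label_zero [DiscreteMeasurableSpace X] (P : Measure (X × X)) [IsProbabilityMeasure P] (C : Clustering X) :
    P.real {p | label C p = 0} = 1 - P.real {p | label C p = 1} := by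
  rw [← probReal_compl_eq_one_sub MeasurableSet.of_discrete]
  congr 1
  ext p
  exact (label_ne_one_iff C p).symm

lemma lossWeight_nonneg (Cs : Clustering X) {w₁ w₂ : ℝ} (h₁ : 0 ≤ w₁) (h₂ : 0 ≤ w₂)
    (hγ : posProb Cs ≤ 1) : 0 ≤ lossWeight Cs w₁ w₂ := by
  have h0 : 0 ≤ posProb Cs := measureReal_nonneg
  have : 0 ≤ 1 - posProb Cs := by linarith
  unfold lossWeight; positivity

lemma lossWeight_le_one (Cs : Clustering X) {w₁ w₂ : ℝ} (h₁ : 0 ≤ w₁) (h₂ : 0 ≤ w₂)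
    (hγ : posProb Cs ≤ 1) : lossWeight Cs w₁ w₂ ≤ 1 := by
  have h0 : 0 ≤ posProb Cs := measureReal_nonneg
  have : 0 ≤ 1 - posProb Cs := by linarith
  have : 0 ≤ w₂ * (1 - posProb Cs) := by positivity
  exact div_le_one_of_le₀ (by linarith) (by positivity)

/-- The sample-size condition passes to half the accuracy and half the confidence. -/
lemma sample_size_halving {D D' m ε δ : ℝ} (hD' : D' ≤ D) (hD : 0 ≤ D) (hε : 0 < ε) (hδ : 0 < δ)
    (hδ1 : δ < 1)
    (hm : 76800 * (D + Real.log (2 / δ)) / ε ^ 2 ≤ m) :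
    9600 * (D' + Real.log (2 / (δ / 2))) ≤ m * (ε / 2) ^ 2 := by
  have hlog : Real.log (2 / (δ / 2)) ≤ 2 * Real.log (2 / δ) := by
    have e : 2 / (δ / 2) = 2 * (2 / δ) := by field_simp
    have h2 : Real.log 2 ≤ Real.log (2 / δ) := by
      apply Real.log_le_log (by norm_num)
      rw [le_div_iff₀ hδ]; linarith
    rw [e, Real.log_mul (by norm_num) (by positivity)]; linarith
  rw [div_le_iff₀ (by positivity)] at hm
  have e : m * (ε / 2) ^ 2 = m * ε ^ 2 / 4 := by ring
  rw [e]; linarith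

open scoped Classical in
/-- Samples on which all empirical frequencies are accurate lead to a near-optimal minimizer. -/
lemma loss_le_of_isERM [DiscreteMeasurableSpace X] {Cs : Clustering X} {w₁ w₂ α ε : ℝ} {F : Finset (Clustering X)}
    {mp mn : ℕ} (hmp : mp ≠ 0) (h₁ : 0 ≤ w₁) (h₂ : 0 ≤ w₂) (hγ : posProb Cs ≤ 1)
    {G : Set (X × X)} (hG : G.Nonempty) (hGsub : G ⊆ posPairs Cs)
    (hα : (uniformOn (posPairs Cs)).real (posPairs Cs \ G) ≤ α)
    {Sp : Fin mp → X × X} {Sn : Fin mn → X × X}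
    (hSp : ∀ h ∈ F.image sameSet, |empFreq Sp h - (uniformOn G).real h| ≤ ε / 2)
    (hSn : ∀ h ∈ F.image sameSet, |empFreq Sn h - (uniformOn (negPairs Cs)).real h| ≤ ε / 2)
    {Chat C : Clustering X} (hChat : Chat ∈ F) (hC : C ∈ F)
    (hmin : empLoss Cs w₁ w₂ Sp Sn Chat ≤ empLoss Cs w₁ w₂ Sp Sn C) :
    loss Cs w₁ w₂ Chat ≤ loss Cs w₁ w₂ C + 3 * α + ε := by
  have : IsProbabilityMeasure (uniformOn G) := isProbabilityMeasure_uniformOn G.toFinite hG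
  have : IsProbabilityMeasure (uniformOn (posPairs Cs)) :=
    isProbabilityMeasure_uniformOn (Set.toFinite _) (hG.mono hGsub)
  have hα0 : 0 ≤ α := measureReal_nonneg.trans hα
  have hw0 := lossWeight_nonneg Cs h₁ h₂ hγ
  have hw1 := lossWeight_le_one Cs h₁ h₂ hγ
  have hset : ∀ C : Clustering X, ((sameSet C : Finset (X × X)) : Set (X × X)) =
      {p | label C p = 1} := fun C => by ext p; simp [sameSet]
  have hpos : ∀ C ∈ F,
      |sampleFreq Sp C 0 - (uniformOn (posPairs Cs)).real {p | label C p = 0}| ≤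
        α + ε / 2 := by
    intro C hC
    have h3 := hSp _ (mem_image_of_mem _ hC)
    rw [← sampleFreq_one_eq, hset] at h3
    have h4 := abs_uniformOn_sub_uniformOn_le hGsub hG hα {p | label C p = 1}
    rw [sampleFreq_zero_eq hmp, real_label_zero]
    rw [abs_le] at h3 h4 ⊢
    constructor <;> linarith [h3.1, h3.2, h4.1, h4.2]
  have hneg : ∀ C ∈ F,
      |sampleFreq Sn C 1 - (uniformOn (negPairs Cs)).real {p | label C p = 1}| ≤ ε / 2 := by
    intro C hC
    have h3 := hSn _ (mem_image_of_mem _ hC)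
    rwa [← sampleFreq_one_eq, hset] at h3
  unfold empLoss at hmin
  unfold loss
  have a1 := abs_le.1 (hpos _ hChat)
  have a2 := abs_le.1 (hpos _ hC)
  have a3 := abs_le.1 (hneg _ hChat)
  have a4 := abs_le.1 (hneg _ hC)
  set w := lossWeight Cs w₁ w₂
  have hw1' : 0 ≤ 1 - w := by linarith
  have b1 := mul_le_mul_of_nonneg_left a1.1 hw0
  have b2 := mul_le_mul_of_nonneg_left a2.2 hw0
  have b3 := mul_le_mul_of_nonneg_left a3.1 hw1'
  have b4 := mul_le_mul_of_nonneg_left a4.2 hw1'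
  -- The two comparisons with the empirical loss cost `2 * w * α + ε` in all, within `3 * α + ε`
  -- because `0 ≤ α`.
  have b5 : w * α ≤ α := mul_le_of_le_one_left hα0 hw1
  nlinarith

end Labels

end CorrClust

/-! ### Assembly of the main theorem. -/

open CorrClust

theorem mainTheorem4 :
    ∃ a : ℝ, 0 < a ∧
      ∀ (X : Type*) [Fintype X] [MeasurableSpace X] [DiscreteMeasurableSpace X]
        (d : X → X → ℝ) (lam : ℝ) (Cs : CorrClust.Clustering X)
        (F : Finset (CorrClust.Clustering X)) (hF : F.Nonempty)
        (w₁ w₂ α β γ ε δ : ℝ) (mp mn : ℕ),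
        0 ≤ w₁ → 0 ≤ w₂ → 0 < w₁ + w₂ →
        0 < ε → ε < 1 → 0 < δ → δ < 1 →
        -- the two sampling loops can terminate
        (∃ x y : X, x ≠ y ∧ d x y ≤ lam ∧ CorrClust.label Cs (x, y) = 1) →
        (∃ x y : X, x ≠ y ∧ CorrClust.label Cs (x, y) = 0) →
        CorrClust.IsInformative d Cs lam α β →
        CorrClust.IsSkewed Cs γ →
        a * ((CorrClust.vcDim F : ℝ) + Real.log (2 / δ)) / ε ^ 2 ≤ (mp : ℝ) →
        a * ((CorrClust.vcDim F : ℝ) + Real.log (2 / δ)) / ε ^ 2 ≤ (mn : ℝ) →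
        1 - δ ≤ (CorrClust.trialsLaw d lam mp mn).real
          {ω | (∃ Chat, CorrClust.IsERMOutput Cs w₁ w₂ F ω Chat) ∧
            ∀ Chat, CorrClust.IsERMOutput Cs w₁ w₂ F ω Chat →
              CorrClust.loss Cs w₁ w₂ Chat ≤
                F.inf' hF (CorrClust.loss Cs w₁ w₂) + 3 * α + ε} := by
  classical
  -- `76800 = 9600 * 4 * 2`: the factor 4 comes from accuracy `ε / 2`, and 2 from `log (4 / δ) ≤ 2 *
  -- log (2 / δ)`, as each sample gets confidence `δ / 2`.
  refine ⟨76800, by norm_num, ?_⟩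
  intro X _ _ _ d lam Cs F hF w₁ w₂ α β γ ε δ mp mn h₁ h₂ _ hε _ hδ hδ1 hposx hnegx hinf _ hmp hmn
  set Ap : Set (X × X) := {p | label Cs p = 1} with hAp
  set An : Set (X × X) := {p | label Cs p = 0} with hAn
  set G : Set (X × X) := closePairs d lam ∩ Ap with hG
  obtain ⟨x, y, hxy, hd, hl⟩ := hposx
  obtain ⟨x', y', hxy', hl'⟩ := hnegx
  have hGne : G.Nonempty := ⟨(x, y), ⟨hxy, hd⟩, hl⟩
  have hNne : (negPairs Cs).Nonempty := ⟨(x', y'), hxy', hl'⟩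
  have hGsub : G ⊆ posPairs Cs := fun p hp => ⟨hp.1.1, hp.2⟩
  have hprobU : IsProbabilityMeasure (unifPairs X) :=
    isProbabilityMeasure_uniformOn (Set.toFinite _) ⟨(x, y), hxy⟩
  have hprobT : IsProbabilityMeasure (posTrial d lam) := by
    rw [posTrial_eq_uniformOn]
    exact isProbabilityMeasure_uniformOn (Set.toFinite _) ⟨(x, y), hxy, hd⟩
  have hprobG : IsProbabilityMeasure (uniformOn G) :=
    isProbabilityMeasure_uniformOn (Set.toFinite _) hGne
  have hprobN : IsProbabilityMeasure (uniformOn (negPairs Cs)) :=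
    isProbabilityMeasure_uniformOn (Set.toFinite _) hNne
  have hAp0 : posTrial d lam Ap ≠ 0 := by
    rw [posTrial_eq_uniformOn, Ne, uniformOn_eq_zero_iff (Set.toFinite _)]
    exact hGne.ne_empty
  have hAn0 : unifPairs X An ≠ 0 := by
    rw [unifPairs, Ne, uniformOn_eq_zero_iff (Set.toFinite _)]
    exact Set.Nonempty.ne_empty ⟨(x', y'), hxy', hl'⟩
  have hlawp : (posTrial d lam)[|Ap] = uniformOn G := by
    rw [posTrial_eq_uniformOn, cond_uniformOn]
  have hlawn : (unifPairs X)[|An] = uniformOn (negPairs Cs) := by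
    rw [unifPairs, cond_uniformOn]; rfl
  have hα : (uniformOn (posPairs Cs)).real (posPairs Cs \ G) ≤ α := by
    have h := hinf.1
    rw [unifPairs, cond_uniformOn] at h
    refine le_trans (measureReal_mono ?_) h
    rintro p ⟨⟨hp1, hp2⟩, hp3⟩
    by_contra hcon
    exact hp3 ⟨⟨hp1, not_lt.1 hcon⟩, hp2⟩
  have hγ1 : posProb Cs ≤ 1 := measureReal_le_one
  have hD : ((F.image sameSet).vcDim : ℝ) ≤ vcDim F := by exact_mod_cast vcDim_image_sameSet_le F
  have hlog : 0 < Real.log (2 / δ) := Real.log_pos (by rw [lt_div_iff₀ hδ]; linarith)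
  have hmp0 : mp ≠ 0 := by
    rintro rfl
    have : (0 : ℝ) < 76800 * ((vcDim F : ℝ) + Real.log (2 / δ)) / ε ^ 2 := by positivity
    push_cast at hmp
    linarith
  set Bp : Set (Fin mp → X × X) :=
    {S | ∃ h ∈ F.image sameSet, ε / 2 < |empFreq S h - (uniformOn G).real h|} with hBp
  set Bn : Set (Fin mn → X × X) :=
    {S | ∃ h ∈ F.image sameSet, ε / 2 < |empFreq S h - (uniformOn (negPairs Cs)).real h|} with hBn
  have hBp1 : (Measure.pi fun _ : Fin mp => (posTrial d lam)[|Ap]) Bp ≤ ENNReal.ofReal (δ / 2) := by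
    rw [hlawp]
    refine measure_exists_lt_abs_empFreq_sub_le_of_card _ _ (by positivity) (by positivity)
      (by linarith) ?_
    rw [Fintype.card_fin]
    exact sample_size_halving hD (by positivity) hε hδ hδ1 hmp
  have hBn1 : (Measure.pi fun _ : Fin mn => (unifPairs X)[|An]) Bn ≤ ENNReal.ofReal (δ / 2) := by
    rw [hlawn]
    refine measure_exists_lt_abs_empFreq_sub_le_of_card _ _ (by positivity) (by positivity)
      (by linarith) ?_
    rw [Fintype.card_fin]
    exact sample_size_halving hD (by positivity) hε hδ hδ1 hmn
  set Np : Set (Fin mp → ℕ → X × X) :=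
    {ω | ¬ ∃ S : Fin mp → X × X, (∀ i, firstAccepted (· ∈ Ap) (ω i) = some (S i)) ∧ S ∉ Bp} with hNp
  set Nn : Set (Fin mn → ℕ → X × X) :=
    {ω | ¬ ∃ S : Fin mn → X × X, (∀ i, firstAccepted (· ∈ An) (ω i) = some (S i)) ∧ S ∉ Bn} with hNn
  have hNp1 := (pi_infinitePi_not_exists_le (κ := Fin mp) (posTrial d lam)
    MeasurableSet.of_discrete hAp0 (bad := Bp) MeasurableSet.of_discrete).trans hBp1
  have hNn1 := (pi_infinitePi_not_exists_le (κ := Fin mn) (unifPairs X)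
    MeasurableSet.of_discrete hAn0 (bad := Bn) MeasurableSet.of_discrete).trans hBn1
  have hprobL : IsProbabilityMeasure (trialsLaw d lam mp mn) := by unfold trialsLaw; infer_instance
  set good := {ω : Trials X mp mn | (∃ Chat, IsERMOutput Cs w₁ w₂ F ω Chat) ∧
    ∀ Chat, IsERMOutput Cs w₁ w₂ F ω Chat →
      loss Cs w₁ w₂ Chat ≤ F.inf' hF (loss Cs w₁ w₂) + 3 * α + ε} with hgood
  have hbad : goodᶜ ⊆ Np ×ˢ Set.univ ∪ Set.univ ×ˢ Nn := by
    intro ω hω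
    by_contra hcon
    simp only [Set.mem_union, Set.mem_prod, Set.mem_univ, and_true, true_and, not_or, hNp, hNn,
      Set.mem_ofPred_eq, not_not] at hcon
    obtain ⟨⟨Sp, hSp, hSpB⟩, Sn, hSn, hSnB⟩ := hcon
    simp only [hBp, hBn, Set.mem_ofPred_eq, not_exists, not_and, not_lt] at hSpB hSnB
    refine hω ⟨?_, ?_⟩
    · obtain ⟨C, hC, hmin⟩ := F.exists_min_image (empLoss Cs w₁ w₂ Sp Sn) hF
      exact ⟨C, Sp, Sn, hSp, hSn, hC, hmin⟩
    · rintro Chat ⟨Sp', Sn', hSp', hSn', hChat, hmin⟩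
      -- The randomness determines the samples, so every possible output, whatever the tie-breaking,
      -- is judged on the same accurate ones.
      obtain rfl : Sp' = Sp := funext fun i => Option.some.inj ((hSp' i).symm.trans (hSp i))
      obtain rfl : Sn' = Sn := funext fun i => Option.some.inj ((hSn' i).symm.trans (hSn i))
      obtain ⟨C, hC, hCinf⟩ := F.exists_mem_eq_inf' hF (loss Cs w₁ w₂)
      rw [hCinf]
      exact loss_le_of_isERM hmp0 h₁ h₂ hγ1 hGne hGsub hα hSpB hSnB hChat hC (hmin C hC)
  have hbadle : trialsLaw d lam mp mn goodᶜ ≤ ENNReal.ofReal δ := by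
    refine (measure_mono hbad).trans ((measure_union_le _ _).trans ?_)
    rw [trialsLaw, Measure.prod_prod, Measure.prod_prod, measure_univ, measure_univ, mul_one,
      one_mul]
    refine (add_le_add hNp1 hNn1).trans (le_of_eq ?_)
    rw [← ENNReal.ofReal_add (by positivity) (by positivity), add_halves]
  have hreal : (trialsLaw d lam mp mn).real goodᶜ ≤ δ := ENNReal.toReal_le_of_le_ofReal hδ.le hbadle
  -- Subadditivity suffices here, so measurability of `good` is not needed.
  have htot : 1 ≤ (trialsLaw d lam mp mn).real good + (trialsLaw d lam mp mn).real goodᶜ := by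
    have := measureReal_union_le (μ := trialsLaw d lam mp mn) good goodᶜ
    rwa [Set.union_compl_self, probReal_univ] at this
  linarith
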